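/- Let $\mathcal H$ be a complex Hilbert space. For a commuting $n$-tuple $\mathbf A=(A_1,\dots,A_n)$ of bounded linear operators on $\mathcal H$, the Taylor spectrum $\sigma_T(\mathbf A)$ is the set of $z=(z_1,\dots,z_n)\in\mathbb C^n$ for which the Koszul complex $$0\to E_n(\mathcal H)\xrightarrow{D_n}E_{n-1}(\mathcal H)\to\cdots\xrightarrow{D_1}E_0(\mathcal H)\to 0,\qquad E_k(\mathcal H)=\mathcal H\otimes\textstyle\bigwedge^k\mathbb C^n,$$ $$D_k(x\otimes e_{j_1}\wedge\cdots\wedge e_{j_k})=\sum_{i=1}^k(-1)^{i-1}(A_{j_i}-z_{j_i})x\otimes e_{j_1}\wedge\cdots\wedge\check e_{j_i}\wedge\cdots\wedge e_{j_k}$$ (where $\check e_{j_i}$ means that $e_{j_i}$ is omitted) is not exact. An operator $T$ is log-hyponormal if it is invertible and $\log|T|\ge\log|T^*|$, where $|T|=(T^*T)^{1/2}$. Let $\mathbf T=(T_1,\dots,T_n)$ be a doubly commuting $n$-tuple of log-hyponormal operators on $\mathcal H$, that is, $T_iT_j=T_jT_i$ for all $i,j$ and $T_iT_j^*=T_j^*T_i$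 for $i\ne j$. Suppose that $\log|T_j|>0$ for every $j$, in the sense that $\langle(\log|T_j|)x,x\rangle>0$ for every non-zero $x\in\mathcal H$. Let $T_j=U_j|T_j|$ be the polar decomposition, with $U_j$ unitary, and let $\mathbf S=(U_1\log|T_1|,\dots,U_n\log|T_n|)$. Then $\mathbf S$ is a commuting $n$-tuple, and $$\sigma_T(\mathbf S)=\{(e^{i\theta_1}\log r_1,\dots,e^{i\theta_n}\log r_n)\;:\;r_j>0,\ \theta_j\in\mathbb R,\ (r_1e^{i\theta_1},\dots,r_ne^{i\theta_n})\in\sigma_T(\mathbf T)\}.$$ -/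

import Mathlib

noncomputable section

/-- The degree `k` part `E^n_k(H) = H ⊗ ⋀^k ℂⁿ` of the Koszul complex, written as the direct sum of
`n.choose k` copies of `H`: the coordinate of `f` at `s = {j₁ < ⋯ < j_k}` is the coefficient
of `e_{j₁} ∧ ⋯ ∧ e_{j_k}`. -/
abbrev KoszulSpace (n : ℕ) (H : Type*) (k : ℕ) : Type _ :=
  {s : Finset (Fin n) // s.card = k} → H

variable {H : Type*} [NormedAddCommGroup H] [InnerProductSpace ℂ H]

/-- The Koszul boundary map `E^n_{k+1}(H) → E^n_k(H)` of a tuple of operators,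
`x ⊗ e_{j₁} ∧ ⋯ ∧ e_{j_{k+1}} ↦ ∑ᵢ (-1)^(i-1) T_{jᵢ} x ⊗ e_{j₁} ∧ ⋯ ěᵢ ⋯ ∧ e_{j_{k+1}}`.
The coefficient of the image at `t` collects the terms of the index sets `insert j t`, `j ∉ t`,
and `j` is preceded in `insert j t` by the elements of `t` below it. -/
def koszulBoundary {n : ℕ} (T : Fin n → H →L[ℂ] H) (k : ℕ) :
    KoszulSpace n H (k + 1) →ₗ[ℂ] KoszulSpace n H k where
  toFun f t := ∑ j : {j : Fin n // j ∉ t.1},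
    (-1 : ℂ) ^ (t.1.filter (· < j.1)).card •
      T j.1 (f ⟨insert j.1 t.1, by rw [Finset.card_insert_of_notMem j.2, t.2]⟩)
  map_add' f g := by
    ext t
    simp [Finset.sum_add_distrib]
  map_smul' c f := by
    ext t
    simp [Finset.smul_sum, smul_comm c]

/-- Exactness of the whole Koszul complex
`0 → E_n(H) → ⋯ → E_1(H) → E_0(H) → 0`. Since `E_k(H) = 0` for `k > n`, exactness at `E_n(H)`
is one of the conditions of the second conjunct (of the first one if `n = 0`). -/
def KoszulExact {n : ℕ} (T : Fin n → H →L[ℂ] H) : Prop :=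
  Function.Surjective (koszulBoundary T 0) ∧
    ∀ k : ℕ, Function.Exact (koszulBoundary T (k + 1)) (koszulBoundary T k)

/-- The Taylor spectrum of a tuple of operators (meant for commuting tuples): the points `z` such
that the Koszul complex of `(T₁ - z₁, …, Tₙ - zₙ)` is not exact. -/
def taylorSpectrum {n : ℕ} (T : Fin n → H →L[ℂ] H) : Set (Fin n → ℂ) :=
  {z | ¬ KoszulExact fun j => T j - z j • (1 : H →L[ℂ] H)}

variable [CompleteSpace H]

/-- `Tᵢ Tⱼ = Tⱼ Tᵢ` for all `i, j` and `Tᵢ Tⱼ* = Tⱼ* Tᵢ` for `i ≠ j`. -/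
def DoublyCommuting {n : ℕ} (T : Fin n → H →L[ℂ] H) : Prop :=
  (∀ i j, Commute (T i) (T j)) ∧ ∀ i j, i ≠ j → Commute (T i) (star (T j))

/-- `T` is invertible and `log |T| ≥ log |T*|`. -/
def IsLogHyponormal (T : H →L[ℂ] H) : Prop :=
  IsUnit T ∧ CFC.log (CFC.abs (star T)) ≤ CFC.log (CFC.abs T)

end

/-!
The proof reduces the Taylor spectra of `T` and `S` to one-sided joint approximate spectra and then
moves the coordinates from `S j` to `T j` one at a time.

For a doubly commuting tuple `A` the Laplacian `D D* + D* D` of the Koszul complex is diagonal, with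
entries `∑_{j ∈ t} Aⱼ* Aⱼ + ∑_{j ∉ t} Aⱼ Aⱼ*`; the complex is exact as soon as all of these are
invertible (`koszulExact_of_isUnit`). Conversely, unit vectors on which all `Aⱼ*` tend to zero
prevent the last Koszul map from being onto (`not_koszulExact_of_jointApproxKernel`). Hence, if
approximate eigenvectors of each `Aⱼ` are also approximate eigenvectors of `Aⱼ*`, a point `z` is in
the Taylor spectrum iff the operators `(Aⱼ - zⱼ)*` have a joint approximate kernel
(`mem_taylorSpectrum_iff`).

Write `L = log|T|` for one of the operators. Log-hyponormality says `U L U* ≤ L`, and `U L` and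
`T = U exp L` are the ends of the path `U f_t(L)`, `f_t(l) = (1 - t) l + t exp l`. The single
estimate `mul_norm_sq_le_of_approx_eigen` shows that an approximate eigenvector of `U f_t(L)` for an
eigenvalue `f_t(a) u ≠ 0` with `|u| = 1` satisfies `L x ≈ a x` and `U* x ≈ ū x`. It is therefore an
approximate eigenvector of `U f_s(L)` and of its adjoint for every `s`, which gives the normality
needed above.

The other coordinates enter through a self-adjoint `B` commuting with `U` and `L`. For `a > 0`
either some `U f_t(L) - f_t(a) u` has an approximate kernel in the approximate kernel of `B`, and
then all the adjoints do, or the path is bounded below relative to `B`, and then the adjoints behave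
alike at both ends by a relative form of the homotopy invariance of the Fredholm index
(`jointApproxKernel_star_path_iff`). At `a = 0` the path gives nothing, since all angles of `T`
collapse to the point `0` of `S`. There the approximate kernel of `L` is invariant under the isometry
`U*`, which has an approximate eigenvalue on the unit circle (`exists_circle_approx_eigen`).
-/

open Filter Topology

/-! ### The Koszul complex and its Laplacian -/

section Exterior

variable {n : ℕ} {M : Type*} [AddCommGroup M] [Module ℂ M]

/-- The sign `(-1) ^ #{i ∈ t | i < j}` picked up when `e_j` is moved into its place in the ordered
wedge product indexed by `t`. -/
def wedgeSign (j : Fin n) (t : Finset (Fin n)) : ℂ := (-1) ^ (t.filter (· < j)).card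

lemma wedgeSign_mul_self (j : Fin n) (t : Finset (Fin n)) : wedgeSign j t * wedgeSign j t = 1 := by
  rw [wedgeSign, ← mul_pow]; simp

lemma wedgeSign_insert (i j : Fin n) (t : Finset (Fin n)) (h : i ∉ t) :
    wedgeSign j (insert i t) = if i < j then -wedgeSign j t else wedgeSign j t := by
  unfold wedgeSign
  rw [Finset.filter_insert]
  split_ifs with hij
  · rw [Finset.card_insert_of_notMem (by simp [h]), pow_succ]; ring
  · rfl

lemma wedgeSign_erase (i j : Fin n) (t : Finset (Fin n)) (h : i ∈ t) :
    wedgeSign j (t.erase i) = if i < j then -wedgeSign j t else wedgeSign j t := by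
  have := wedgeSign_insert i j (t.erase i) (Finset.notMem_erase i t)
  rw [Finset.insert_erase h] at this
  rw [this]
  split_ifs <;> simp

/-- Contraction with the `j`-th basis covector on `M ⊗ ⋀ ℂⁿ`, all degrees of the exterior algebra
taken together. -/
def contract (j : Fin n) : Module.End ℂ (Finset (Fin n) → M) where
  toFun f t := if j ∈ t then 0 else wedgeSign j t • f (insert j t)
  map_add' f g := by ext t; by_cases h : j ∈ t <;> simp [h]
  map_smul' c f := by ext t; by_cases h : j ∈ t <;> simp [h, smul_comm c]

/-- The exterior product with `e_j` on `M ⊗ ⋀ ℂⁿ`. -/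
def wedge (j : Fin n) : Module.End ℂ (Finset (Fin n) → M) where
  toFun f t := if j ∈ t then wedgeSign j t • f (t.erase j) else 0
  map_add' f g := by ext t; by_cases h : j ∈ t <;> simp [h]
  map_smul' c f := by ext t; by_cases h : j ∈ t <;> simp [h, smul_comm c]

lemma contract_apply (j : Fin n) (f : Finset (Fin n) → M) (t : Finset (Fin n)) :
    contract j f t = if j ∈ t then 0 else wedgeSign j t • f (insert j t) := rfl

lemma wedge_apply (j : Fin n) (f : Finset (Fin n) → M) (t : Finset (Fin n)) :
    wedge j f t = if j ∈ t then wedgeSign j t • f (t.erase j) else 0 := rfl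

lemma contract_mul_contract (i j : Fin n) :
    (contract i * contract j + contract j * contract i : Module.End ℂ (Finset (Fin n) → M)) = 0 := by
  refine LinearMap.ext fun f => funext fun t => ?_
  simp only [Module.End.mul_apply, LinearMap.add_apply, Pi.add_apply, LinearMap.zero_apply,
    Pi.zero_apply, contract_apply]
  rcases eq_or_ne i j with rfl | hij
  · simp
  by_cases hi : i ∈ t <;> by_cases hj : j ∈ t <;> simp only [hi, hj, if_true, if_false,
    Finset.mem_insert, hij, hij.symm, or_true, or_self, smul_zero, add_zero]
  rw [wedgeSign_insert _ _ _ hi, wedgeSign_insert _ _ _ hj, Finset.insert_comm]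
  rcases lt_or_gt_of_ne hij with h | h <;>
    simp [h, h.not_gt, smul_smul, mul_comm]

lemma contract_mul_wedge_of_ne {i j : Fin n} (hij : i ≠ j) :
    (contract i * wedge j + wedge j * contract i : Module.End ℂ (Finset (Fin n) → M)) = 0 := by
  refine LinearMap.ext fun f => funext fun t => ?_
  simp only [Module.End.mul_apply, LinearMap.add_apply, Pi.add_apply, LinearMap.zero_apply,
    Pi.zero_apply, contract_apply, wedge_apply]
  by_cases hi : i ∈ t <;> by_cases hj : j ∈ t <;> simp only [hi, hj, if_true, if_false,
    Finset.mem_insert, hij, hij.symm, or_true, or_self, smul_zero, add_zero, Finset.mem_erase,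
    ne_eq, not_false_eq_true, true_and]
  rw [wedgeSign_insert _ _ _ hi, wedgeSign_erase _ _ _ hj, Finset.erase_insert_of_ne hij]
  rcases lt_or_gt_of_ne hij with h | h <;>
    simp [h, h.not_gt, smul_smul, mul_comm]

lemma contract_wedge_self_apply (i : Fin n) (f : Finset (Fin n) → M) (t : Finset (Fin n)) :
    contract i (wedge i f) t = if i ∈ t then 0 else f t := by
  rw [contract_apply, wedge_apply]
  by_cases hi : i ∈ t
  · simp [hi]
  · simp [hi, wedgeSign_insert, smul_smul, wedgeSign_mul_self]

lemma wedge_contract_self_apply (i : Fin n) (f : Finset (Fin n) → M) (t : Finset (Fin n)) :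
    wedge i (contract i f) t = if i ∈ t then f t else 0 := by
  rw [wedge_apply, contract_apply]
  by_cases hi : i ∈ t
  · simp [hi, wedgeSign_erase, smul_smul, wedgeSign_mul_self]
  · simp [hi]

/-- The operator `A ⊗ 1` on `M ⊗ ⋀ ℂⁿ`. -/
def coordwise (A : Module.End ℂ M) : Module.End ℂ (Finset (Fin n) → M) :=
  A.compLeft (Finset (Fin n))

lemma coordwise_apply (A : Module.End ℂ M) (f : Finset (Fin n) → M) (t : Finset (Fin n)) :
    coordwise A f t = A (f t) := rfl

lemma coordwise_mul (A B : Module.End ℂ M) :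
    (coordwise A * coordwise B : Module.End ℂ (Finset (Fin n) → M)) = coordwise (A * B) := rfl

lemma contract_mul_coordwise (j : Fin n) (A : Module.End ℂ M) :
    contract j * coordwise A = coordwise A * contract j := by
  refine LinearMap.ext fun f => funext fun t => ?_
  simp only [Module.End.mul_apply, coordwise_apply, contract_apply]
  split_ifs <;> simp

lemma wedge_mul_coordwise (j : Fin n) (A : Module.End ℂ M) :
    wedge j * coordwise A = coordwise A * wedge j := by
  refine LinearMap.ext fun f => funext fun t => ?_
  simp only [Module.End.mul_apply, coordwise_apply, wedge_apply]
  split_ifs <;> simp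

/-- The Koszul boundary `∑ⱼ Aⱼ ⊗ contract j` on all degrees at once. -/
def totalBoundary (A : Fin n → Module.End ℂ M) : Module.End ℂ (Finset (Fin n) → M) :=
  ∑ j, coordwise (A j) * contract j

/-- The operator `∑ⱼ Bⱼ ⊗ wedge j` on all degrees at once; for `B j = (A j)†` it is the adjoint of
`totalBoundary A`. -/
def totalCoboundary (B : Fin n → Module.End ℂ M) : Module.End ℂ (Finset (Fin n) → M) :=
  ∑ j, coordwise (B j) * wedge j

lemma coordwise_mul_mul (A B : Module.End ℂ M) (a b : Module.End ℂ (Finset (Fin n) → M))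
    (h : a * coordwise B = coordwise B * a) :
    coordwise A * a * (coordwise B * b) = coordwise (A * B) * (a * b) := by
  rw [← coordwise_mul, mul_assoc, ← mul_assoc a, h]
  simp only [mul_assoc]

lemma totalBoundary_mul_self (A : Fin n → Module.End ℂ M) (hA : ∀ i j, Commute (A i) (A j)) :
    totalBoundary A * totalBoundary A = 0 := by
  have key : totalBoundary A * totalBoundary A + totalBoundary A * totalBoundary A = 0 := by
    conv_lhs => enter [2]; rw [totalBoundary, Finset.sum_mul_sum, Finset.sum_comm]
    rw [totalBoundary, Finset.sum_mul_sum, ← Finset.sum_add_distrib]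
    refine Finset.sum_eq_zero fun i _ => ?_
    rw [← Finset.sum_add_distrib]
    refine Finset.sum_eq_zero fun j _ => ?_
    rw [coordwise_mul_mul _ _ _ _ (contract_mul_coordwise _ _),
      coordwise_mul_mul _ _ _ _ (contract_mul_coordwise _ _), (hA j i).eq, ← mul_add,
      contract_mul_contract, mul_zero]
  rw [← two_smul ℂ] at key
  exact (smul_eq_zero.mp key).resolve_left two_ne_zero

/-- The Koszul Laplacian of a doubly commuting tuple is diagonal: the off-diagonal terms cancel by
the anticommutation relations. -/
lemma laplacian_apply (A B : Fin n → Module.End ℂ M) (hAB : ∀ i j, i ≠ j → Commute (A i) (B j))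
    (f : Finset (Fin n) → M) (t : Finset (Fin n)) :
    (totalBoundary A * totalCoboundary B + totalCoboundary B * totalBoundary A) f t =
      (∑ j, if j ∈ t then B j * A j else A j * B j) (f t) := by
  have h1 : totalBoundary A * totalCoboundary B + totalCoboundary B * totalBoundary A =
      ∑ i, (coordwise (A i * B i) * (contract i * wedge i) +
        coordwise (B i * A i) * (wedge i * contract i)) := by
    rw [totalBoundary, totalCoboundary, Finset.sum_mul_sum, Finset.sum_mul_sum,
      Finset.sum_comm (f := fun i j => coordwise (B i) * wedge i * (coordwise (A j) * contract j)),
      ← Finset.sum_add_distrib]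
    refine Finset.sum_congr rfl fun i _ => ?_
    rw [← Finset.sum_add_distrib]
    rw [Finset.sum_eq_single i]
    · rw [coordwise_mul_mul _ _ _ _ (contract_mul_coordwise _ _),
        coordwise_mul_mul _ _ _ _ (wedge_mul_coordwise _ _)]
    · intro j _ hj
      rw [coordwise_mul_mul _ _ _ _ (contract_mul_coordwise _ _),
        coordwise_mul_mul _ _ _ _ (wedge_mul_coordwise _ _), (hAB i j hj.symm).eq,
        ← mul_add, contract_mul_wedge_of_ne hj.symm, mul_zero]
    · simp
  rw [h1]
  simp only [LinearMap.sum_apply, Finset.sum_apply, LinearMap.add_apply, Pi.add_apply,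
    Module.End.mul_apply, coordwise_apply, contract_wedge_self_apply, wedge_contract_self_apply]
  refine Finset.sum_congr rfl fun i _ => ?_
  by_cases h : i ∈ t <;> simp [h]

lemma totalBoundary_apply (A : Fin n → Module.End ℂ M) (f : Finset (Fin n) → M)
    (t : Finset (Fin n)) : totalBoundary A f t =
      ∑ j : {j : Fin n // j ∉ t}, wedgeSign j.1 t • A j.1 (f (insert j.1 t)) := by
  simp only [totalBoundary, LinearMap.sum_apply, Finset.sum_apply, Module.End.mul_apply,
    coordwise_apply, contract_apply]
  rw [← Finset.sum_subtype (Finset.univ.filter (· ∉ t)) (by simp)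
    (fun j => wedgeSign j t • A j (f (insert j t))), Finset.sum_filter]
  refine Finset.sum_congr rfl fun i _ => ?_
  by_cases h : i ∈ t <;> simp [h]

/-- If the Laplacian of a doubly commuting tuple is bijective, every cycle is a boundary. -/
lemma exists_totalBoundary_eq (A B : Fin n → Module.End ℂ M) (hA : ∀ i j, Commute (A i) (A j))
    (hAB : ∀ i j, i ≠ j → Commute (A i) (B j))
    (hP : ∀ t : Finset (Fin n), IsUnit (∑ j, if j ∈ t then B j * A j else A j * B j))
    {f : Finset (Fin n) → M} (hf : totalBoundary A f = 0) : ∃ g, totalBoundary A g = f := by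
  have bij t := (Module.End.isUnit_iff _).mp (hP t)
  choose g hg using fun t => (bij t).2 (f t)
  set D := totalBoundary A
  set D' := totalCoboundary B
  have hΔ : (D * D' + D' * D) g = f := by
    funext t
    rw [laplacian_apply A B hAB, hg]
  have hDD := totalBoundary_mul_self A hA
  have hcomm : D * (D * D' + D' * D) = (D * D' + D' * D) * D := by
    rw [mul_add, add_mul, ← mul_assoc D D, hDD, mul_assoc D' D D, hDD]
    simp [mul_assoc]
  -- the Laplacian commutes with `D` and is injective, so `D g = 0`
  have hDg : D g = 0 := by
    have h2 : (D * D' + D' * D) (D g) = 0 := by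
      rw [← Module.End.mul_apply, ← hcomm, Module.End.mul_apply, hΔ, hf]
    funext t
    have h3 := congrFun h2 t
    rw [laplacian_apply A B hAB, Pi.zero_apply] at h3
    exact (bij t).1 (by rw [h3, Pi.zero_apply, map_zero])
  refine ⟨D' g, ?_⟩
  rw [← hΔ, LinearMap.add_apply, Module.End.mul_apply, Module.End.mul_apply, hDg, map_zero,
    add_zero]

end Exterior

section KoszulComplex

variable {H : Type*} [NormedAddCommGroup H] {n : ℕ}

/-- The degree `k` component of an element of `H ⊗ ⋀ ℂⁿ`. -/
def degreePart (k : ℕ) (f : Finset (Fin n) → H) : KoszulSpace n H k := fun t => f t.1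

/-- An element of degree `k` as an element of `H ⊗ ⋀ ℂⁿ`. -/
def ofDegree (k : ℕ) (f : KoszulSpace n H k) : Finset (Fin n) → H :=
  fun t => if h : t.card = k then f ⟨t, h⟩ else 0

lemma degreePart_ofDegree (k : ℕ) (f : KoszulSpace n H k) : degreePart k (ofDegree k f) = f := by
  funext t
  simp [degreePart, ofDegree, t.2]

variable [InnerProductSpace ℂ H]

lemma degreePart_totalBoundary (A : Fin n → H →L[ℂ] H) (k : ℕ) (f : Finset (Fin n) → H) :
    degreePart k (totalBoundary (fun j => (A j : H →ₗ[ℂ] H)) f) =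
      koszulBoundary A k (degreePart (k + 1) f) := by
  funext t
  rw [degreePart, totalBoundary_apply]
  rfl

lemma totalBoundary_ofDegree_succ (A : Fin n → H →L[ℂ] H) (k : ℕ) (f : KoszulSpace n H (k + 1)) :
    totalBoundary (fun j => (A j : H →ₗ[ℂ] H)) (ofDegree (k + 1) f) =
      ofDegree k (koszulBoundary A k f) := by
  funext t
  by_cases ht : t.card = k
  · have h := congrFun (degreePart_totalBoundary A k (ofDegree (k + 1) f)) ⟨t, ht⟩
    rw [degreePart_ofDegree] at h
    simpa [ofDegree, ht, degreePart] using h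
  · rw [totalBoundary_apply]
    simp only [ofDegree, ht, dite_false]
    refine Finset.sum_eq_zero fun j _ => ?_
    rw [dif_neg (by rw [Finset.card_insert_of_notMem j.2]; omega), map_zero, smul_zero]

lemma totalBoundary_ofDegree_zero (A : Fin n → H →L[ℂ] H) (f : KoszulSpace n H 0) :
    totalBoundary (fun j => (A j : H →ₗ[ℂ] H)) (ofDegree 0 f) = 0 := by
  funext t
  rw [totalBoundary_apply]
  refine Finset.sum_eq_zero fun j _ => ?_
  simp [ofDegree]

variable [CompleteSpace H]

/-- The Koszul complex of a doubly commuting tuple is exact as soon as every diagonal entry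
`∑_{j ∈ t} Aⱼ* Aⱼ + ∑_{j ∉ t} Aⱼ Aⱼ*` of the Koszul Laplacian is invertible. -/
lemma koszulExact_of_isUnit {A : Fin n → H →L[ℂ] H} (hA : DoublyCommuting A)
    (hP : ∀ t : Finset (Fin n),
      IsUnit (∑ j, if j ∈ t then star (A j) * A j else A j * star (A j))) :
    KoszulExact A := by
  let ψ : (H →L[ℂ] H) →+* Module.End ℂ H := ContinuousLinearMap.toLinearMapRingHom
  have hcomm : ∀ i j, Commute (A i : Module.End ℂ H) (A j) := fun i j => (hA.1 i j).map ψ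
  have key : ∀ f : Finset (Fin n) → H, totalBoundary (fun j => (A j : H →ₗ[ℂ] H)) f = 0 →
      ∃ g, totalBoundary (fun j => (A j : H →ₗ[ℂ] H)) g = f := by
    refine fun f => exists_totalBoundary_eq _ (fun j => (star (A j) : H →L[ℂ] H).toLinearMap) hcomm
      (fun i j hij => (hA.2 i j hij).map ψ) fun t => ?_
    convert (hP t).map ψ using 1
    rw [map_sum]
    refine Finset.sum_congr rfl fun j _ => ?_
    split_ifs <;> rfl
  constructor
  · intro f
    obtain ⟨g, hg⟩ := key _ (totalBoundary_ofDegree_zero A f)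
    refine ⟨degreePart 1 g, ?_⟩
    rw [← degreePart_totalBoundary, hg, degreePart_ofDegree]
  · intro k f
    constructor
    · intro hf
      obtain ⟨g, hg⟩ := key (ofDegree (k + 1) f) (by
        rw [totalBoundary_ofDegree_succ, hf]; funext t; simp [ofDegree])
      refine ⟨degreePart (k + 2) g, ?_⟩
      rw [← degreePart_totalBoundary, hg, degreePart_ofDegree]
    · rintro ⟨g, rfl⟩
      rw [← degreePart_ofDegree _ g, ← degreePart_totalBoundary, ← degreePart_totalBoundary,
        ← Module.End.mul_apply, totalBoundary_mul_self _ hcomm]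
      rfl

/-- The tuple `C` has a joint approximate kernel: there are unit vectors on which all `C i` tend to
zero. -/
def JointApproxKernel {ι : Type*} (C : ι → H →L[ℂ] H) : Prop :=
  ∃ x : ℕ → H, (∀ k, ‖x k‖ = 1) ∧ ∀ i, Tendsto (fun k => C i (x k)) atTop (𝓝 0)

/-- If the adjoints of a tuple have a joint approximate kernel, the last map of the Koszul complex
is not onto: by the open mapping theorem the unit vectors would have bounded preimages. -/
lemma not_koszulExact_of_jointApproxKernel {A : Fin n → H →L[ℂ] H}
    (h : JointApproxKernel fun j => star (A j)) : ¬ KoszulExact A := by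
  rintro ⟨hsurj, -⟩
  obtain ⟨x, hx1, hx⟩ := h
  let D : KoszulSpace n H 1 →L[ℂ] KoszulSpace n H 0 :=
    ⟨koszulBoundary A 0, by
      refine continuous_pi fun t => ?_
      change Continuous fun f : KoszulSpace n H 1 => ∑ j : {j : Fin n // j ∉ t.1}, (_ : ℂ) • A j.1 (f _)
      fun_prop⟩
  obtain ⟨C, hC0, hC⟩ := D.exists_preimage_norm_le hsurj
  choose f hf hfC using fun k => hC fun _ => x k
  let e : {s : Finset (Fin n) // s.card = 0} := ⟨∅, rfl⟩
  have hfn : ∀ k, ‖f k‖ ≤ C := fun k => by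
    refine (hfC k).trans ?_
    have : ‖(fun _ => x k : KoszulSpace n H 0)‖ ≤ 1 :=
      (pi_norm_le_iff_of_nonneg zero_le_one).mpr fun _ => (hx1 k).le
    nlinarith
  have hb : ∀ k, (1 : ℝ) ≤ ∑ j, C * ‖star (A j) (x k)‖ := fun k => by
    have h1 := congrFun (hf k) e
    have h2 : (1 : ℝ) = ‖inner ℂ (x k) (D (f k) e)‖ := by
      rw [h1, inner_self_eq_norm_sq_to_K, hx1]; simp
    have h3 : D (f k) e = ∑ j : {j : Fin n // j ∉ (∅ : Finset (Fin n))},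
        (-1 : ℂ) ^ ((∅ : Finset (Fin n)).filter (· < j.1)).card •
          A j.1 (f k ⟨insert j.1 ∅, by simp⟩) := rfl
    rw [h2, h3, inner_sum]
    refine (norm_sum_le _ _).trans ?_
    rw [Finset.sum_subtype Finset.univ (p := (· ∉ (∅ : Finset (Fin n)))) (by simp)
      fun j => C * ‖star (A j) (x k)‖]
    refine Finset.sum_le_sum fun j _ => ?_
    rw [Finset.filter_empty, Finset.card_empty, pow_zero, one_smul,
      ← ContinuousLinearMap.adjoint_inner_left, mul_comm C]
    exact (norm_inner_le_norm _ _).trans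
      (mul_le_mul_of_nonneg_left ((norm_le_pi_norm (f k) _).trans (hfn k)) (norm_nonneg _))
  have hlim : Tendsto (fun k => ∑ j, C * ‖star (A j) (x k)‖) atTop (𝓝 0) := by
    have := tendsto_finsetSum (Finset.univ : Finset (Fin n)) fun j _ =>
      ((hx j).norm.const_mul C)
    simpa using this
  exact absurd (ge_of_tendsto' hlim hb) (by norm_num)

end KoszulComplex

/-! ### Joint approximate kernels -/

section JointApproxKernel

variable {H : Type*} [NormedAddCommGroup H] [InnerProductSpace ℂ H]

lemma not_jointApproxKernel_iff {ι : Type*} [Fintype ι] {C : ι → H →L[ℂ] H} :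
    ¬ JointApproxKernel C ↔ ∃ c > 0, ∀ x : H, c * ‖x‖ ^ 2 ≤ ∑ i, ‖C i x‖ ^ 2 := by
  constructor
  · intro h
    by_contra! hc
    refine h ?_
    have hpos : ∀ k : ℕ, (0 : ℝ) < 1 / (k + 1) := fun k => by positivity
    choose y hy using fun k : ℕ => hc (1 / (k + 1)) (hpos k)
    have hy0 : ∀ k, 0 < ‖y k‖ := fun k => by
      rw [norm_pos_iff]
      intro h0
      have := hy k
      rw [h0] at this
      simp at this
    refine ⟨fun k => ((‖y k‖⁻¹ : ℝ) : ℂ) • y k, fun k => ?_, fun i => ?_⟩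
    · rw [norm_smul, Complex.norm_real, norm_inv, norm_norm, inv_mul_cancel₀ (hy0 k).ne']
    · have hle : ∀ k, ‖C i (((‖y k‖⁻¹ : ℝ) : ℂ) • y k)‖ ^ 2 ≤ 1 / ((k : ℝ) + 1) := fun k => by
        rw [map_smul, norm_smul, Complex.norm_real, norm_inv, norm_norm, mul_pow, inv_pow,
          inv_mul_le_iff₀ (pow_pos (hy0 k) 2), mul_comm]
        exact (Finset.single_le_sum (f := fun i => ‖C i (y k)‖ ^ 2) (fun _ _ => sq_nonneg _)
          (Finset.mem_univ i)).trans (hy k).le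
      have hlim := squeeze_zero (fun k => sq_nonneg _) hle tendsto_one_div_add_atTop_nhds_zero_nat
      rw [tendsto_zero_iff_norm_tendsto_zero]
      simpa using hlim.sqrt
  · rintro ⟨c, hc0, hc⟩ ⟨x, hx1, hx⟩
    have hlim : Tendsto (fun k => ∑ i, ‖C i (x k)‖ ^ 2) atTop (𝓝 0) := by
      have := tendsto_finsetSum (Finset.univ : Finset ι) fun i _ => ((hx i).norm.pow 2)
      simpa using this
    have := ge_of_tendsto' hlim fun k => (by simpa [hx1] using hc (x k) :
      c ≤ ∑ i, ‖C i (x k)‖ ^ 2)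
    linarith

lemma jointApproxKernel_pair_iff {B A : H →L[ℂ] H} : JointApproxKernel ![B, A] ↔
    ∃ x : ℕ → H, (∀ k, ‖x k‖ = 1) ∧ Tendsto (fun k => B (x k)) atTop (𝓝 0) ∧
      Tendsto (fun k => A (x k)) atTop (𝓝 0) := by
  simp only [JointApproxKernel, Fin.forall_fin_two, Matrix.cons_val_zero, Matrix.cons_val_one]

lemma re_inner_le_norm_of_norm_eq_one {x y : H} (hx : ‖x‖ = 1) : (inner ℂ y x).re ≤ ‖y‖ := by
  simpa [hx] using re_inner_le_norm (𝕜 := ℂ) y x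

lemma norm_sq_apply_le {A A' : H →L[ℂ] H} {η : ℝ} (h : ‖A - A'‖ ≤ η) (x : H) :
    ‖A x‖ ^ 2 ≤ 2 * ‖A' x‖ ^ 2 + 2 * η ^ 2 * ‖x‖ ^ 2 := by
  have h1 : ‖A x‖ ≤ ‖A' x‖ + η * ‖x‖ := by
    have h2 : ‖A x - A' x‖ ≤ η * ‖x‖ := by
      rw [← sub_apply]
      exact (A - A').le_of_opNorm_le h x
    linarith [norm_le_norm_add_norm_sub' (A x) (A' x)]
  nlinarith [norm_nonneg (A x), sq_nonneg (‖A' x‖ - η * ‖x‖)]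

variable [CompleteSpace H]

lemma re_inner_star_mul_self (C : H →L[ℂ] H) (x : H) :
    (inner ℂ ((star C * C) x) x).re = ‖C x‖ ^ 2 := by
  change (inner ℂ (ContinuousLinearMap.adjoint C (C x)) x).re = _
  rw [ContinuousLinearMap.adjoint_inner_left, inner_self_eq_norm_sq_to_K]
  norm_cast

lemma re_inner_sum_star_mul_self {ι : Type*} (s : Finset ι) (C : ι → H →L[ℂ] H) (x : H) :
    (inner ℂ ((∑ i ∈ s, star (C i) * C i) x) x).re = ∑ i ∈ s, ‖C i x‖ ^ 2 := by
  rw [sum_apply, sum_inner, Complex.re_sum]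
  exact Finset.sum_congr rfl fun i _ => re_inner_star_mul_self _ _

lemma jointApproxKernel_of_not_isUnit {ι : Type*} [Fintype ι] {C : ι → H →L[ℂ] H}
    (h : ¬ IsUnit (∑ i, star (C i) * C i)) : JointApproxKernel C := by
  by_contra hC
  obtain ⟨c, hc0, hc⟩ := not_jointApproxKernel_iff.mp hC
  refine h (ContinuousLinearMap.isUnit_of_forall_le_norm_inner_map _ (c := ⟨c, hc0.le⟩) hc0
    fun x => ?_)
  calc ‖x‖ ^ 2 * c ≤ ∑ i, ‖C i x‖ ^ 2 := by rw [mul_comm]; exact hc x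
    _ = (inner ℂ ((∑ i, star (C i) * C i) x) x).re := (re_inner_sum_star_mul_self _ _ _).symm
    _ ≤ _ := Complex.re_le_norm _

/-- A self-adjoint operator which is not invertible has an approximate kernel. -/
lemma exists_approxKernel_of_isSelfAdjoint {Q : H →L[ℂ] H} (hQ : IsSelfAdjoint Q)
    (h : ¬ IsUnit Q) :
    ∃ x : ℕ → H, (∀ k, ‖x k‖ = 1) ∧ Tendsto (fun k => Q (x k)) atTop (𝓝 0) := by
  have h2 : ¬ IsUnit (∑ _i : Unit, star Q * Q) := by
    rw [Finset.univ_unique, Finset.sum_singleton, hQ.star_eq]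
    exact fun hu => h ((Commute.refl Q).isUnit_mul_iff.mp hu).1
  obtain ⟨x, hx1, hx⟩ := jointApproxKernel_of_not_isUnit (C := fun _ : Unit => Q) h2
  exact ⟨x, hx1, hx ()⟩

/-- A commuting self-adjoint `B` localises the joint lower bounds of `(B, A)` and `(B, A*)`. If
`(B, A)` is bounded below with constant `c` and `(B, A*)` has no joint approximate kernel, then after
weighting `B` heavily `(B, A*)` is bounded below with a constant that depends on `c` only. The reason
is that `A* A` and `A A*` have the same spectrum away from their kernels: an approximate eigenvector
`x` of `N B² + A A*` with eigenvalue `μ < c / 2` is nearly annihilated by `A*`, so `‖B x‖ ^ 2` is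
about `μ / N`, which for large `N` contradicts the lower bound of `(B, A*)`. -/
lemma exists_weight_lower_bound {B A : H →L[ℂ] H} (hB : IsSelfAdjoint B) (hAB : Commute B A)
    {c : ℝ} (hc0 : 0 < c) (hc : ∀ x : H, c * ‖x‖ ^ 2 ≤ ‖B x‖ ^ 2 + ‖A x‖ ^ 2)
    (hker : ¬ JointApproxKernel ![B, star A]) :
    ∃ N : ℝ, 0 < N ∧ ∀ x : H, c / 2 * ‖x‖ ^ 2 ≤ N * ‖B x‖ ^ 2 + ‖star A x‖ ^ 2 := by
  obtain ⟨δ, hδ0, hδ⟩ := not_jointApproxKernel_iff.mp hker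
  simp only [Fin.sum_univ_two, Matrix.cons_val_zero, Matrix.cons_val_one] at hδ
  -- `1 ≤ N` keeps the lower bound `c` of `(B, A)`, and `c ≤ N δ` makes `μ / N` smaller than `δ`
  set N : ℝ := max 1 (c / δ)
  have hN1 : 1 ≤ N := le_max_left _ _
  have hN0 : 0 < N := by linarith
  have hNδ : c ≤ N * δ := (div_le_iff₀ hδ0).mp (le_max_right _ _)
  refine ⟨N, hN0, ?_⟩
  set P : H →L[ℂ] H := (N : ℂ) • (star B * B) + A * star A
  set Q : H →L[ℂ] H := (N : ℂ) • (star B * B) + star A * A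
  have hPf : ∀ x, (inner ℂ (P x) x).re = N * ‖B x‖ ^ 2 + ‖star A x‖ ^ 2 := fun x => by
    have h1 := re_inner_star_mul_self B x
    have h2 := re_inner_star_mul_self (star A) x
    rw [star_star] at h2
    rw [add_apply, smul_apply, inner_add_left,
      inner_smul_left, Complex.add_re, h2, Complex.conj_ofReal, Complex.re_ofReal_mul, h1]
  have hQf : ∀ x, (inner ℂ (Q x) x).re = N * ‖B x‖ ^ 2 + ‖A x‖ ^ 2 := fun x => by
    have h1 := re_inner_star_mul_self B x
    have h2 := re_inner_star_mul_self A x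
    rw [add_apply, smul_apply, inner_add_left,
      inner_smul_left, Complex.add_re, h2, Complex.conj_ofReal, Complex.re_ofReal_mul, h1]
  have hPsa : IsSelfAdjoint P := by
    rw [isSelfAdjoint_iff, star_add, star_smul, star_mul, star_mul, star_star, star_star]
    congr 2
    exact Complex.conj_ofReal N
  have hspec : ∀ μ ∈ spectrum ℝ P, c / 2 ≤ μ := by
    intro μ hμ
    by_contra! hlt
    have hsa : IsSelfAdjoint (algebraMap ℝ (H →L[ℂ] H) μ - P) :=
      (IsSelfAdjoint.algebraMap _ (IsSelfAdjoint.all μ)).sub hPsa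
    obtain ⟨x, hx1, hx⟩ := exists_approxKernel_of_isSelfAdjoint hsa (spectrum.mem_iff.mp hμ)
    have happ : ∀ y : H, algebraMap ℝ (H →L[ℂ] H) μ y = (μ : ℂ) • y := fun y => by
      rw [Algebra.algebraMap_eq_smul_one]; simp
    have hx' : Tendsto (fun k => P (x k) - (μ : ℂ) • x k) atTop (𝓝 0) := by
      have := hx.neg
      simpa [happ] using this
    have hQlow : ∀ y : H, c / 2 * ‖y‖ ≤ ‖Q y - (μ : ℂ) • y‖ := fun y => by
      rcases eq_or_ne y 0 with rfl | hy
      · simp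
      have hy0 := norm_pos_iff.mpr hy
      have h1 : (inner ℂ (Q y - (μ : ℂ) • y) y).re = N * ‖B y‖ ^ 2 + ‖A y‖ ^ 2 - μ * ‖y‖ ^ 2 := by
        rw [inner_sub_left, inner_smul_left, Complex.sub_re, hQf, Complex.conj_ofReal,
          Complex.re_ofReal_mul, inner_self_eq_norm_sq_to_K]
        norm_cast
      have h2 := re_inner_le_norm (𝕜 := ℂ) (Q y - (μ : ℂ) • y) y
      rw [RCLike.re_eq_complex_re, h1] at h2
      have h3 := hc y
      have h4 : ‖B y‖ ^ 2 ≤ N * ‖B y‖ ^ 2 := le_mul_of_one_le_left (sq_nonneg _) hN1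
      nlinarith
    have hQP : ∀ y, Q (star A y) - (μ : ℂ) • star A y = star A (P y - (μ : ℂ) • y) := fun y => by
      have hBA : Commute B (star A) := by simpa [hB.star_eq] using hAB.star_star
      have hBBA : (star B * B) * star A = star A * (star B * B) := by
        rw [hB.star_eq]; exact (hBA.mul_left hBA).eq
      have : Q * star A = star A * P := by
        simp only [P, Q, add_mul, mul_add, smul_mul_assoc, mul_smul_comm, hBBA, mul_assoc]
      rw [map_sub, map_smul]
      exact congrArg (· - (μ : ℂ) • star A y) (congrArg (· y) this)
    have hA : Tendsto (fun k => star A (x k)) atTop (𝓝 0) := by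
      have h1 : Tendsto (fun k => ‖star A (P (x k) - (μ : ℂ) • x k)‖) atTop (𝓝 0) := by
        have := ((star A).continuous.tendsto 0).comp hx'
        rw [map_zero] at this
        simpa using this.norm
      rw [tendsto_zero_iff_norm_tendsto_zero]
      refine squeeze_zero (fun _ => norm_nonneg _) (fun k => ?_)
        (by simpa only [mul_zero] using h1.const_mul (2 / c))
      have h2 := hQlow (star A (x k))
      rw [hQP] at h2
      rw [div_mul_eq_mul_div, le_div_iff₀ hc0]
      linarith
    have hlim : Tendsto (fun k => ‖P (x k) - (μ : ℂ) • x k‖ + μ + N * ‖star A (x k)‖ ^ 2) atTop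
        (𝓝 μ) := by
      simpa using (hx'.norm.add_const μ).add ((hA.norm.pow 2).const_mul N)
    -- pairing `P x - μ x` with `x` bounds `N (‖B x‖ ^ 2 + ‖A* x‖ ^ 2)` up to `N ‖A* x‖ ^ 2`
    have hge : N * δ ≤ μ := ge_of_tendsto' hlim fun k => by
      have h1 := hδ (x k)
      have h2 : (inner ℂ (P (x k) - (μ : ℂ) • x k) (x k)).re =
          N * ‖B (x k)‖ ^ 2 + ‖star A (x k)‖ ^ 2 - μ := by
        rw [inner_sub_left, inner_smul_left, Complex.sub_re, hPf, Complex.conj_ofReal,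
          Complex.re_ofReal_mul, inner_self_eq_norm_sq_to_K, hx1]
        simp
      have h3 := re_inner_le_norm_of_norm_eq_one (y := P (x k) - (μ : ℂ) • x k) (hx1 k)
      rw [hx1] at h1
      nlinarith [sq_nonneg ‖star A (x k)‖]
    linarith
  have hle := (algebraMap_le_iff_le_spectrum (r := c / 2) hPsa).mpr hspec
  intro x
  rw [← hPf]
  have h1 := ((ContinuousLinearMap.le_def _ _).mp hle).re_inner_nonneg_left x
  rw [Algebra.algebraMap_eq_smul_one] at h1
  have h2 : ((c / 2 : ℝ) • (1 : H →L[ℂ] H)) x = ((c / 2 : ℝ) : ℂ) • x :=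
    (Complex.coe_smul (c / 2) x).symm
  rw [sub_apply, inner_sub_left, h2, inner_smul_left, Complex.conj_ofReal,
    map_sub, RCLike.re_eq_complex_re, Complex.re_ofReal_mul] at h1
  have h3 : (inner ℂ x x).re = ‖x‖ ^ 2 := inner_self_eq_norm_sq (𝕜 := ℂ) x
  rw [h3] at h1
  linarith

/-- Having no joint approximate kernel of `(B, A*)` is stable under perturbations of `A` whose size is
controlled by the lower bound of `(B, A)` alone. -/
lemma not_jointApproxKernel_star_of_norm_sub_le {B A A' : H →L[ℂ] H} (hB : IsSelfAdjoint B)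
    (hAB : Commute B A) {c : ℝ} (hc0 : 0 < c)
    (hc : ∀ x : H, c * ‖x‖ ^ 2 ≤ ‖B x‖ ^ 2 + ‖A x‖ ^ 2)
    (hker : ¬ JointApproxKernel ![B, star A]) {η : ℝ} (hη : 8 * η ^ 2 ≤ c) (hAA : ‖A - A'‖ ≤ η) :
    ¬ JointApproxKernel ![B, star A'] := by
  obtain ⟨N, hN0, hN⟩ := exists_weight_lower_bound hB hAB hc0 hc hker
  set K := max N 2
  have hK : 0 < K := lt_of_lt_of_le hN0 (le_max_left _ _)
  refine not_jointApproxKernel_iff.mpr ⟨c / 4 / K, by positivity, fun x => ?_⟩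
  simp only [Fin.sum_univ_two, Matrix.cons_val_zero, Matrix.cons_val_one]
  rw [div_mul_eq_mul_div, div_le_iff₀ hK]
  have h1 := hN x
  have h2 : ‖star A x‖ ^ 2 ≤ 2 * ‖star A' x‖ ^ 2 + 2 * η ^ 2 * ‖x‖ ^ 2 :=
    norm_sq_apply_le (by rwa [← star_sub, norm_star]) x
  have h3 : N * ‖B x‖ ^ 2 ≤ K * ‖B x‖ ^ 2 :=
    mul_le_mul_of_nonneg_right (le_max_left _ _) (sq_nonneg _)
  have h4 : 2 * ‖star A' x‖ ^ 2 ≤ K * ‖star A' x‖ ^ 2 :=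
    mul_le_mul_of_nonneg_right (le_max_right _ _) (sq_nonneg _)
  have h5 : 8 * η ^ 2 * ‖x‖ ^ 2 ≤ c * ‖x‖ ^ 2 := mul_le_mul_of_nonneg_right hη (sq_nonneg _)
  linarith

/-- Homotopy invariance, the relative form of the stability of the Fredholm index: along a path of
operators `A t` that stay bounded below jointly with `B`, surjectivity of `A t` relative to `B`
cannot change. -/
theorem jointApproxKernel_star_path_iff {B : H →L[ℂ] H} (hB : IsSelfAdjoint B)
    {A : unitInterval → H →L[ℂ] H} (hA : Continuous A) (hAB : ∀ t, Commute B (A t))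
    (hker : ∀ t, ¬ JointApproxKernel ![B, A t]) :
    JointApproxKernel ![B, star (A 0)] ↔ JointApproxKernel ![B, star (A 1)] := by
  have hloc : IsLocallyConstant fun t => JointApproxKernel ![B, star (A t)] := by
    rw [IsLocallyConstant.iff_eventually_eq]
    intro t
    obtain ⟨c, hc0, hc⟩ := not_jointApproxKernel_iff.mp (hker t)
    simp only [Fin.sum_univ_two, Matrix.cons_val_zero, Matrix.cons_val_one] at hc
    obtain ⟨η, hη0, hη⟩ : ∃ η > 0, 8 * η ^ 2 ≤ c / 4 := by
      refine ⟨√(c / 32), Real.sqrt_pos.mpr (by positivity), ?_⟩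
      rw [Real.sq_sqrt (by positivity)]
      linarith
    filter_upwards [Metric.continuousAt_iff'.mp hA.continuousAt η hη0] with s hs
    rw [dist_eq_norm] at hs
    have hs' : ‖A t - A s‖ ≤ η := by rw [norm_sub_rev]; exact hs.le
    have hc' : ∀ x : H, c / 4 * ‖x‖ ^ 2 ≤ ‖B x‖ ^ 2 + ‖A s x‖ ^ 2 := fun x => by
      have h1 := hc x
      have h2 := norm_sq_apply_le hs' x
      have h5 : 8 * η ^ 2 * ‖x‖ ^ 2 ≤ c / 4 * ‖x‖ ^ 2 :=
        mul_le_mul_of_nonneg_right hη (sq_nonneg _)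
      nlinarith [sq_nonneg ‖B x‖]
    refine propext (not_iff_not.mp ⟨fun h => ?_, fun h => ?_⟩)
    · exact not_jointApproxKernel_star_of_norm_sub_le hB (hAB s) (by positivity) hc' h hη hs.le
    · exact not_jointApproxKernel_star_of_norm_sub_le hB (hAB t) hc0 hc h (by linarith) hs'
  exact (hloc.apply_eq_of_isPreconnected isPreconnected_univ (Set.mem_univ 0)
    (Set.mem_univ 1)).to_iff

/-- All members of a family but the `j`-th can be packed into the single self-adjoint operator
`∑_{i ≠ j} Cᵢ* Cᵢ`. -/
lemma jointApproxKernel_iff_pair {ι : Type*} [Fintype ι] [DecidableEq ι] (C : ι → H →L[ℂ] H)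
    (j : ι) : JointApproxKernel C ↔
      JointApproxKernel ![∑ i ∈ Finset.univ.erase j, star (C i) * C i, C j] := by
  rw [jointApproxKernel_pair_iff]
  constructor
  · rintro ⟨x, hx1, hx⟩
    refine ⟨x, hx1, ?_, hx j⟩
    simp only [sum_apply]
    rw [← Finset.sum_const_zero (s := Finset.univ.erase j)]
    refine tendsto_finsetSum _ fun i _ => ?_
    have := ((star (C i)).continuous.tendsto 0).comp (hx i)
    rwa [map_zero] at this
  · rintro ⟨x, hx1, hx0, hxj⟩
    refine ⟨x, hx1, fun i => ?_⟩
    rcases eq_or_ne i j with rfl | hij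
    · exact hxj
    have hle : ∀ k, ‖C i (x k)‖ ^ 2 ≤
        ‖(∑ i ∈ Finset.univ.erase j, star (C i) * C i) (x k)‖ := fun k => by
      refine le_trans ?_ (re_inner_le_norm_of_norm_eq_one (hx1 k))
      rw [re_inner_sum_star_mul_self]
      exact Finset.single_le_sum (f := fun i => ‖C i (x k)‖ ^ 2) (fun _ _ => sq_nonneg _)
        (Finset.mem_erase.mpr ⟨hij, Finset.mem_univ i⟩)
    have hlim := squeeze_zero (fun k => sq_nonneg _) hle
      (tendsto_zero_iff_norm_tendsto_zero.mp hx0)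
    rw [tendsto_zero_iff_norm_tendsto_zero]
    simpa using hlim.sqrt

end JointApproxKernel

/-! ### Operators `U f(L)` with `U` unitary, `L ≥ 0` and `U L U* ≤ L` -/

section PolarPath

lemma sq_le_exp_sub_exp_mul {a b : ℝ} (ha : 0 ≤ a) (hb : 0 ≤ b) :
    (a - b) ^ 2 ≤ (Real.exp a - Real.exp b) * (a - b) := by
  have key : ∀ a b : ℝ, 0 ≤ b → b ≤ a → a - b ≤ Real.exp a - Real.exp b := fun a b hb hab => by
    have h1 := Real.add_one_le_exp (a - b)
    have h2 := Real.one_le_exp hb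
    have h3 : Real.exp a = Real.exp b * Real.exp (a - b) := by rw [← Real.exp_add]; ring_nf
    nlinarith
  rcases le_total b a with h | h
  · nlinarith [key a b hb h]
  · nlinarith [key b a ha h]

lemma abs_exp_sub_exp_le {a b M : ℝ} (ha : a ≤ M) (hb : b ≤ M) :
    |Real.exp a - Real.exp b| ≤ Real.exp M * |a - b| := by
  have key : ∀ a b : ℝ, a ≤ M → b ≤ a → Real.exp a - Real.exp b ≤ Real.exp M * (a - b) :=
    fun a b ha hab => by
      have h1 := Real.add_one_le_exp (b - a)
      have h3 : Real.exp b = Real.exp a * Real.exp (b - a) := by rw [← Real.exp_add]; ring_nf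
      have h4 := Real.exp_le_exp.mpr ha
      have h5 := Real.exp_pos a
      nlinarith
  rcases le_total b a with h | h
  · rw [abs_of_nonneg (sub_nonneg.mpr (Real.exp_le_exp.mpr h)), abs_of_nonneg (sub_nonneg.mpr h)]
    exact key a b ha h
  · rw [abs_of_nonpos (sub_nonpos.mpr (Real.exp_le_exp.mpr h)), abs_of_nonpos (sub_nonpos.mpr h),
      neg_sub, neg_sub]
    exact key b a hb h

/-- The segment of functions joining the identity (`t = 0`) to the exponential (`t = 1`). -/
noncomputable def linExp (t l : ℝ) : ℝ := (1 - t) * l + t * Real.exp l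

@[fun_prop]
lemma continuous_linExp (t : ℝ) : Continuous (linExp t) := by unfold linExp; fun_prop

lemma linExp_zero : linExp 0 = id := by funext l; simp [linExp]

lemma linExp_one : linExp 1 = Real.exp := by funext l; simp [linExp]

lemma linExp_nonneg {t l : ℝ} (ht : t ∈ Set.Icc (0 : ℝ) 1) (hl : 0 ≤ l) : 0 ≤ linExp t l :=
  add_nonneg (mul_nonneg (by linarith [ht.2]) hl) (mul_nonneg ht.1 (Real.exp_pos l).le)

lemma linExp_pos {t l : ℝ} (ht : t ∈ Set.Icc (0 : ℝ) 1) (hl : 0 < l) : 0 < linExp t l := by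
  have h1 := Real.add_one_le_exp l
  have h2 := ht.1
  unfold linExp
  nlinarith

/-- Strict monotonicity of `linExp t` on `[0, ∞)` in the quantitative form used for operators. -/
lemma mul_sq_le_linExp {t l a : ℝ} (ht : t ∈ Set.Icc (0 : ℝ) 1) (hl : 0 ≤ l) (ha : 0 ≤ a) :
    linExp t a * (l - a) ^ 2 ≤ (l - a) * (linExp t l ^ 2 - linExp t a ^ 2) := by
  have h1 : (l - a) ^ 2 ≤ (linExp t l - linExp t a) * (l - a) := by
    have := mul_le_mul_of_nonneg_left (sq_le_exp_sub_exp_mul hl ha) ht.1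
    unfold linExp
    nlinarith
  have h2 := linExp_nonneg ht hl
  have h3 := linExp_nonneg ht ha
  nlinarith [sq_nonneg (l - a), mul_nonneg h2 (sub_nonneg.mpr h1), mul_nonneg h3 (sub_nonneg.mpr h1),
    mul_nonneg h2 (sq_nonneg (l - a))]

lemma abs_linExp_sub_le {t l a M : ℝ} (ht : t ∈ Set.Icc (0 : ℝ) 1) (hl : l ≤ M) (ha : a ≤ M) :
    |linExp t l - linExp t a| ≤ (1 + Real.exp M) * |l - a| := by
  have h1 := abs_exp_sub_exp_le hl ha
  have h2 : linExp t l - linExp t a = (1 - t) * (l - a) + t * (Real.exp l - Real.exp a) := by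
    unfold linExp; ring
  rw [h2]
  refine (abs_add_le _ _).trans ?_
  rw [abs_mul, abs_mul, abs_of_nonneg ht.1, abs_of_nonneg (sub_nonneg.mpr ht.2)]
  nlinarith [ht.1, ht.2, abs_nonneg (l - a), abs_nonneg (Real.exp l - Real.exp a)]

variable {H : Type*} [NormedAddCommGroup H] [InnerProductSpace ℂ H]

lemma re_inner_le_of_le {S T : H →L[ℂ] H} (h : S ≤ T) (x : H) :
    (inner ℂ (S x) x).re ≤ (inner ℂ (T x) x).re := by
  have := ((ContinuousLinearMap.le_def _ _).mp h).re_inner_nonneg_left x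
  rw [sub_apply, inner_sub_left, map_sub] at this
  simpa using this

lemma re_inner_real_smul (r : ℝ) (x y : H) :
    (inner ℂ (r • x) y).re = r * (inner ℂ x y).re := by
  rw [← Complex.coe_smul, inner_smul_left, Complex.conj_ofReal, Complex.re_ofReal_mul]

variable [CompleteSpace H]

lemma re_inner_mul_mul_self {F : H →L[ℂ] H} (hF : IsSelfAdjoint F) (S : H →L[ℂ] H) (x : H) :
    (inner ℂ ((F * S * F) x) x).re = (inner ℂ (S (F x)) (F x)).re := by
  conv_rhs => rw [← ContinuousLinearMap.adjoint_inner_left, ← ContinuousLinearMap.star_eq_adjoint,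
    hF.star_eq]
  rfl

lemma re_inner_mul_self {F : H →L[ℂ] H} (hF : IsSelfAdjoint F) (x : H) :
    (inner ℂ ((F * F) x) x).re = ‖F x‖ ^ 2 := by
  conv_lhs => rw [← hF.star_eq]
  rw [← re_inner_star_mul_self, hF.star_eq]

lemma cfc_isSelfAdjoint (f : ℝ → ℝ) (L : H →L[ℂ] H) : IsSelfAdjoint (cfc f L) := cfc_predicate f L

/-- Domination of functions on the spectrum gives domination of the functional calculus on
vectors. -/
lemma norm_cfc_apply_le {L : H →L[ℂ] H} {f g : ℝ → ℝ} (hf : Continuous f) (hg : Continuous g)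
    {C : ℝ} (hC : 0 ≤ C) (h : ∀ l ∈ spectrum ℝ L, |f l| ≤ C * |g l|) (x : H) :
    ‖cfc f L x‖ ≤ C * ‖cfc g L x‖ := by
  have hop : cfc f L * cfc f L ≤ (C ^ 2) • (cfc g L * cfc g L) := by
    rw [← cfc_mul f f L, ← cfc_mul g g L, ← cfc_smul (C ^ 2) _ L]
    refine cfc_mono fun l hl => ?_
    have h1 := mul_self_le_mul_self (abs_nonneg _) (h l hl)
    rw [abs_mul_abs_self] at h1
    have h2 := abs_mul_abs_self (g l)
    simp only [smul_eq_mul]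
    nlinarith
  have h1 := re_inner_le_of_le hop x
  rw [re_inner_mul_self (cfc_isSelfAdjoint f L), smul_apply, re_inner_real_smul,
    re_inner_mul_self (cfc_isSelfAdjoint g L), ← mul_pow] at h1
  exact le_of_sq_le_sq h1 (by positivity)

lemma norm_apply_of_mem_unitary {U : H →L[ℂ] H} (hU : U ∈ unitary (H →L[ℂ] H)) (x : H) :
    ‖U x‖ = ‖x‖ := by
  have h := re_inner_star_mul_self U x
  rw [Unitary.star_mul_self_of_mem hU] at h
  have h2 : (inner ℂ x x).re = ‖x‖ ^ 2 := inner_self_eq_norm_sq (𝕜 := ℂ) x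
  exact ((sq_eq_sq₀ (norm_nonneg _) (norm_nonneg _)).mp (h2.symm.trans h)).symm

lemma star_apply_apply_of_mem_unitary {U : H →L[ℂ] H} (hU : U ∈ unitary (H →L[ℂ] H)) (x : H) :
    star U (U x) = x :=
  congrArg (fun V : H →L[ℂ] H => V x) (Unitary.star_mul_self_of_mem hU)

variable {U L : H →L[ℂ] H}

lemma re_inner_star_apply_le (hUL : U * L * star U ≤ L) (x : H) :
    (inner ℂ (L (star U x)) (star U x)).re ≤ (inner ℂ (L x) x).re := by
  refine le_trans (le_of_eq ?_) (re_inner_le_of_le hUL x)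
  rw [ContinuousLinearMap.star_eq_adjoint, ContinuousLinearMap.adjoint_inner_right]
  rfl

lemma cfc_sub_const_apply (hL : 0 ≤ L) {f : ℝ → ℝ} (hf : Continuous f) (a : ℝ) (x : H) :
    cfc (fun l => f l - a) L x = cfc f L x - (a : ℂ) • x := by
  have hsa : IsSelfAdjoint L := .of_nonneg hL
  rw [cfc_sub f (fun _ => a) L, cfc_const a L, Algebra.algebraMap_eq_smul_one, Complex.coe_smul]
  rfl

lemma cfc_linExp (hL : 0 ≤ L) (t : ℝ) : cfc (linExp t) L = (1 - t) • L + t • cfc Real.exp L := by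
  have hsa : IsSelfAdjoint L := .of_nonneg hL
  unfold linExp
  rw [cfc_add (a := L) (fun l => (1 - t) * l) (fun l => t * Real.exp l),
    cfc_const_mul (1 - t) (fun l : ℝ => l) L, cfc_const_mul t Real.exp L, cfc_id' ℝ L]

/-- Let `f = linExp t` and `r = f a > 0`. With `y = f(L) x` and `v = r u U* x` the inequality
`U L U* ≤ L` says `⟨L v, v⟩ ≤ r² ⟨L x, x⟩`, so `⟨(L - a) (f(L)² - r²) x, x⟩` is at most
`⟨L y, y⟩ - ⟨L v, v⟩ - a (‖y‖² - ‖v‖²)`, which is small when `y - v` is. As `f` is increasing, the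
same quantity dominates `r ‖(L - a) x‖²`. -/
lemma mul_norm_sq_le_of_approx_eigen (hU : U ∈ unitary (H →L[ℂ] H)) (hL : 0 ≤ L)
    (hUL : U * L * star U ≤ L) {t a : ℝ} (ht : t ∈ Set.Icc (0 : ℝ) 1) (ha : 0 ≤ a) {u : ℂ}
    (hu : ‖u‖ = 1) {x : H} (hx : ‖x‖ = 1) {d : ℝ}
    (hd : ‖(U * cfc (linExp t) L) x - ((linExp t a : ℂ) * u) • x‖ = d) :
    linExp t a * ‖cfc (fun l => l - a) L x‖ ^ 2 ≤ (‖L‖ + a) * d * (2 * linExp t a + d) := by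
  have hsa : IsSelfAdjoint L := .of_nonneg hL
  set r := linExp t a
  have hr : 0 ≤ r := linExp_nonneg ht ha
  set F := cfc (linExp t) L
  set K := cfc (fun l => l - a) L
  have hF : IsSelfAdjoint F := cfc_isSelfAdjoint _ _
  have hK : IsSelfAdjoint K := cfc_isSelfAdjoint _ _
  have hop : r • (K * K) ≤ F * L * F - r ^ 2 • L - a • (F * F - r ^ 2 • (1 : H →L[ℂ] H)) := by
    have e1 : r • (K * K) = cfc (fun l => r * ((l - a) * (l - a))) L := by
      rw [cfc_const_mul r (fun l => (l - a) * (l - a)) L, cfc_mul (fun l => l - a) (fun l => l - a) L]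
    have e2 : F * L * F - r ^ 2 • L - a • (F * F - r ^ 2 • (1 : H →L[ℂ] H)) =
        cfc (fun l => linExp t l * l * linExp t l - r ^ 2 * l -
          a * (linExp t l * linExp t l - r ^ 2)) L := by
      rw [cfc_sub (fun l => linExp t l * l * linExp t l - r ^ 2 * l)
          (fun l => a * (linExp t l * linExp t l - r ^ 2)) L,
        cfc_sub (fun l => linExp t l * l * linExp t l) (fun l => r ^ 2 * l) L,
        cfc_const_mul a (fun l => linExp t l * linExp t l - r ^ 2) L,
        cfc_sub (fun l => linExp t l * linExp t l) (fun _ => r ^ 2) L,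
        cfc_const_mul (r ^ 2) (fun l : ℝ => l) L, cfc_const (r ^ 2) L,
        cfc_mul (fun l => linExp t l * l) (linExp t) L, cfc_mul (linExp t) (fun l : ℝ => l) L,
        cfc_mul (linExp t) (linExp t) L, cfc_id' ℝ L, Algebra.algebraMap_eq_smul_one]
    rw [e1, e2]
    refine cfc_mono fun l hl => ?_
    have := mul_sq_le_linExp ht (spectrum_nonneg_of_nonneg hL hl) ha
    nlinarith
  have h1 := re_inner_le_of_le hop x
  rw [smul_apply, re_inner_real_smul, re_inner_mul_self hK, sub_apply, sub_apply, smul_apply,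
    smul_apply, sub_apply, smul_apply, inner_sub_left, inner_sub_left, Complex.sub_re,
    Complex.sub_re, re_inner_real_smul, re_inner_real_smul, inner_sub_left, Complex.sub_re,
    re_inner_real_smul, re_inner_mul_mul_self hF, re_inner_mul_self hF] at h1
  have h2 : (inner ℂ ((1 : H →L[ℂ] H) x) x).re = 1 := by
    have : (inner ℂ x x).re = ‖x‖ ^ 2 := inner_self_eq_norm_sq (𝕜 := ℂ) x
    rw [hx] at this
    simpa using this
  rw [h2] at h1
  set y := F x
  set v := ((r : ℂ) * u) • star U x
  have hv : ‖v‖ = r := by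
    rw [norm_smul, norm_mul, hu, Complex.norm_real,
      norm_apply_of_mem_unitary (Unitary.star_mem hU), hx, Real.norm_of_nonneg hr]
    ring
  have hyv : ‖y - v‖ = d := by
    have : y - v = star U ((U * F) x - ((r : ℂ) * u) • x) := by
      rw [map_sub, map_smul]
      exact congrArg (· - v) (star_apply_apply_of_mem_unitary hU (F x)).symm
    rw [this, norm_apply_of_mem_unitary (Unitary.star_mem hU), hd]
  have hy : ‖y‖ ≤ r + d := by
    have := norm_le_norm_add_norm_sub' y v
    rw [hv, hyv] at this
    exact this
  have h3 : (inner ℂ (L v) v).re ≤ r ^ 2 * (inner ℂ (L x) x).re := by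
    have h4 : (inner ℂ (L v) v).re = r ^ 2 * (inner ℂ (L (star U x)) (star U x)).re := by
      have huu : (starRingEnd ℂ) ((r : ℂ) * u) * ((r : ℂ) * u) = ((r ^ 2 : ℝ) : ℂ) := by
        rw [mul_comm, Complex.mul_conj, Complex.normSq_eq_norm_sq, norm_mul, hu, Complex.norm_real,
          mul_one, Real.norm_of_nonneg hr]
      rw [map_smul, inner_smul_left, inner_smul_right, ← mul_assoc, huu, Complex.re_ofReal_mul]
    rw [h4]
    exact mul_le_mul_of_nonneg_left (re_inner_star_apply_le hUL x) (sq_nonneg r)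
  have h5 : (inner ℂ (L y) y).re - (inner ℂ (L v) v).re ≤ ‖L‖ * d * (2 * r + d) := by
    have e : inner ℂ (L y) y - inner ℂ (L v) v = inner ℂ (L (y - v)) y + inner ℂ (L v) (y - v) := by
      rw [map_sub, inner_sub_left, inner_sub_right]; ring
    rw [← Complex.sub_re, e, Complex.add_re]
    have b1 : (inner ℂ (L (y - v)) y).re ≤ ‖L‖ * d * ‖y‖ :=
      (re_inner_le_norm (𝕜 := ℂ) _ _).trans (mul_le_mul_of_nonneg_right
        (by rw [← hyv]; exact L.le_opNorm _) (norm_nonneg _))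
    have b2 : (inner ℂ (L v) (y - v)).re ≤ ‖L‖ * r * d := by
      refine (re_inner_le_norm (𝕜 := ℂ) _ _).trans ?_
      rw [hyv]
      exact mul_le_mul_of_nonneg_right (by rw [← hv]; exact L.le_opNorm _) (hyv ▸ norm_nonneg _)
    have hLd : 0 ≤ ‖L‖ * d := mul_nonneg (norm_nonneg _) (hyv ▸ norm_nonneg _)
    nlinarith [mul_le_mul_of_nonneg_left hy hLd]
  have h6 : r ^ 2 - ‖y‖ ^ 2 ≤ d * (2 * r + d) := by
    have h7 : r ≤ ‖y‖ + d := by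
      have := norm_le_norm_add_norm_sub y v
      rwa [hv, hyv] at this
    have hd0 : 0 ≤ d := hyv ▸ norm_nonneg _
    have hr2 : r ^ 2 ≤ (‖y‖ + d) ^ 2 := pow_le_pow_left₀ hr h7 2
    nlinarith [norm_nonneg y, mul_le_mul_of_nonneg_left hy hd0]
  nlinarith [mul_le_mul_of_nonneg_left h6 ha]


lemma tendsto_linExp_of_tendsto {t a : ℝ} (ht : t ∈ Set.Icc (0 : ℝ) 1)
    {x : ℕ → H} (hx : Tendsto (fun k => cfc (fun l => l - a) L (x k)) atTop (𝓝 0)) :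
    Tendsto (fun k => cfc (fun l => linExp t l - linExp t a) L (x k)) atTop (𝓝 0) := by
  set M := max (‖L‖ * ‖(1 : H →L[ℂ] H)‖) a
  have hn := (hx.norm.const_mul (1 + Real.exp M))
  rw [norm_zero, mul_zero] at hn
  rw [tendsto_zero_iff_norm_tendsto_zero]
  refine squeeze_zero (fun _ => norm_nonneg _) (fun k => ?_) hn
  refine norm_cfc_apply_le (by fun_prop) (by fun_prop) (by positivity) (fun l hl => ?_) _
  exact abs_linExp_sub_le ht ((le_abs_self l).trans ((spectrum.norm_le_norm_mul_of_mem hl).trans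
    (le_max_left _ _))) (le_max_right _ _)

/-- An approximate eigenvector of `U f(L)`, `f = linExp t`, with eigenvalue `f a · u ≠ 0` is a joint
approximate eigenvector of `L` and `U*`. -/
lemma tendsto_of_approx_eigen (hU : U ∈ unitary (H →L[ℂ] H)) (hL : 0 ≤ L)
    (hUL : U * L * star U ≤ L) {t a : ℝ} (ht : t ∈ Set.Icc (0 : ℝ) 1) (ha : 0 ≤ a)
    (hr : 0 < linExp t a) {u : ℂ} (hu : ‖u‖ = 1) {x : ℕ → H} (hx1 : ∀ k, ‖x k‖ = 1)
    (hx : Tendsto (fun k => (U * cfc (linExp t) L) (x k) - ((linExp t a : ℂ) * u) • x k) atTop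
      (𝓝 0)) :
    Tendsto (fun k => cfc (fun l => l - a) L (x k)) atTop (𝓝 0) ∧
      Tendsto (fun k => star U (x k) - star u • x k) atTop (𝓝 0) := by
  have hK : Tendsto (fun k => cfc (fun l => l - a) L (x k)) atTop (𝓝 0) := by
    have hn := hx.norm
    rw [norm_zero] at hn
    have hb : Tendsto (fun k => ((‖L‖ + a) *
        ‖(U * cfc (linExp t) L) (x k) - ((linExp t a : ℂ) * u) • x k‖ * (2 * linExp t a +
        ‖(U * cfc (linExp t) L) (x k) - ((linExp t a : ℂ) * u) • x k‖)) / linExp t a) atTop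
        (𝓝 0) := by
      have := ((hn.const_mul (‖L‖ + a)).mul (hn.const_add (2 * linExp t a))).div_const (linExp t a)
      simpa only [mul_zero, zero_mul, zero_div] using this
    have hle := squeeze_zero (fun k => sq_nonneg ‖cfc (fun l => l - a) L (x k)‖) (fun k => by
      rw [le_div_iff₀ hr, mul_comm]
      exact mul_norm_sq_le_of_approx_eigen hU hL hUL ht ha hu (hx1 k) rfl) hb
    rw [tendsto_zero_iff_norm_tendsto_zero]
    simpa using hle.sqrt
  refine ⟨hK, ?_⟩
  have hF := tendsto_linExp_of_tendsto ht hK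
  -- `r u (U* x - ū x) = (f(L) x - r x) - U* (U f(L) x - r u x)`
  have h1 := hF.sub (((star U).continuous.tendsto 0).comp hx)
  rw [map_zero, sub_zero] at h1
  have h2 := h1.const_smul ((linExp t a : ℂ) * u)⁻¹
  rw [smul_zero] at h2
  refine h2.congr fun k => ?_
  have hu0 : u ≠ 0 := by rintro rfl; simp at hu
  have hr0 : (linExp t a : ℂ) ≠ 0 := by exact_mod_cast hr.ne'
  have huu : star u = u⁻¹ := (Complex.inv_eq_conj hu).symm
  have hs : star U ((U * cfc (linExp t) L) (x k)) = cfc (linExp t) L (x k) :=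
    star_apply_apply_of_mem_unitary hU _
  simp only [Function.comp_apply, map_sub, map_smul, hs]
  rw [cfc_sub_const_apply hL (continuous_linExp t), sub_sub_sub_cancel_left, smul_sub, smul_smul,
    smul_smul, inv_mul_cancel₀ (mul_ne_zero hr0 hu0), one_smul, huu, mul_inv, mul_comm,
    mul_inv_cancel_left₀ hr0]

/-- A joint approximate eigenvector of `L` and `U*` is an approximate eigenvector of the adjoint of
every operator on the path. -/
lemma tendsto_star_sub_of_tendsto (hL : 0 ≤ L) {t a : ℝ} (ht : t ∈ Set.Icc (0 : ℝ) 1) {u : ℂ}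
    {x : ℕ → H} (hx : Tendsto (fun k => cfc (fun l => l - a) L (x k)) atTop (𝓝 0))
    (hUx : Tendsto (fun k => star U (x k) - star u • x k) atTop (𝓝 0)) :
    Tendsto (fun k => star (U * cfc (linExp t) L - ((linExp t a : ℂ) * u) • (1 : H →L[ℂ] H)) (x k))
      atTop (𝓝 0) := by
  have h1 := ((cfc (linExp t) L).continuous.tendsto 0).comp hUx
  have h2 := (tendsto_linExp_of_tendsto ht hx).const_smul (star u)
  rw [map_zero] at h1
  rw [smul_zero] at h2
  have h3 := h1.add h2
  rw [add_zero] at h3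
  refine h3.congr fun k => ?_
  have hr : star (linExp t a : ℂ) = linExp t a := Complex.conj_ofReal _
  rw [star_sub, star_smul, star_one, sub_apply, smul_apply, one_apply_eq_self,
    star_mul' (linExp t a : ℂ) u, hr, star_mul, (cfc_isSelfAdjoint (linExp t) L).star_eq,
    cfc_sub_const_apply hL (continuous_linExp t), Function.comp_apply, map_sub, map_smul, smul_sub,
    smul_smul, mul_comm (star u), sub_add_sub_cancel]
  rfl

/-- Away from `0`, the right joint approximate spectrum relative to `B` follows the path
`U linExp t (L)`. If one operator of the path has an approximate eigenvector in the kernel of `B`,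
all their adjoints do; otherwise the whole path is bounded below and homotopy invariance applies. -/
lemma jointApproxKernel_star_iff_of_pos (hU : U ∈ unitary (H →L[ℂ] H)) (hL : 0 ≤ L)
    (hUL : U * L * star U ≤ L) {B : H →L[ℂ] H} (hB : IsSelfAdjoint B) (hBU : Commute B U)
    (hBL : Commute B L) {a : ℝ} (ha : 0 < a) {u : ℂ} (hu : ‖u‖ = 1) :
    JointApproxKernel ![B, star (U * L - ((a : ℂ) * u) • (1 : H →L[ℂ] H))] ↔
      JointApproxKernel ![B, star (U * cfc Real.exp L -
        ((Real.exp a : ℂ) * u) • (1 : H →L[ℂ] H))] := by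
  have hsa : IsSelfAdjoint L := .of_nonneg hL
  let A : unitInterval → H →L[ℂ] H := fun t =>
    U * cfc (linExp t) L - ((linExp t a : ℂ) * u) • (1 : H →L[ℂ] H)
  have hA0 : A 0 = U * L - ((a : ℂ) * u) • (1 : H →L[ℂ] H) := by
    simp only [A, Set.Icc.coe_zero, linExp_zero, cfc_id ℝ L, id]
  have hA1 : A 1 = U * cfc Real.exp L - ((Real.exp a : ℂ) * u) • (1 : H →L[ℂ] H) := by
    simp only [A, Set.Icc.coe_one, linExp_one]
  rw [← hA0, ← hA1]
  by_cases h : ∃ t, JointApproxKernel ![B, A t]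
  · obtain ⟨t, ht⟩ := h
    obtain ⟨x, hx1, hxB, hxA⟩ := jointApproxKernel_pair_iff.mp ht
    obtain ⟨hK, hUx⟩ := tendsto_of_approx_eigen hU hL hUL t.2 ha.le (linExp_pos t.2 ha) hu hx1
      hxA
    have hall : ∀ s, JointApproxKernel ![B, star (A s)] := fun s =>
      jointApproxKernel_pair_iff.mpr
        ⟨x, hx1, hxB, tendsto_star_sub_of_tendsto hL s.2 hK hUx⟩
    exact iff_of_true (hall 0) (hall 1)
  · refine jointApproxKernel_star_path_iff hB ?_ (fun t => ?_) (not_exists.mp h)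
    · simp only [A, cfc_linExp hL]
      unfold linExp
      fun_prop
    · refine (hBU.mul_right (hsa.commute_cfc hBL.symm _).symm).sub_right ?_
      exact (Commute.one_right B).smul_right _

lemma norm_sq_apply_le_re_inner (hL : 0 ≤ L) :
    ∃ M : ℝ, ∀ x : H, ‖L x‖ ^ 2 ≤ M * (inner ℂ (L x) x).re := by
  have hsa : IsSelfAdjoint L := .of_nonneg hL
  refine ⟨‖L‖ * ‖(1 : H →L[ℂ] H)‖, fun x => ?_⟩
  have hop : L * L ≤ (‖L‖ * ‖(1 : H →L[ℂ] H)‖) • L := by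
    have e1 : L * L = cfc (fun l : ℝ => l * l) L := by
      rw [cfc_mul (fun l : ℝ => l) (fun l : ℝ => l) L, cfc_id' ℝ L]
    have e2 : (‖L‖ * ‖(1 : H →L[ℂ] H)‖) • L =
        cfc (fun l : ℝ => (‖L‖ * ‖(1 : H →L[ℂ] H)‖) * l) L := by
      rw [cfc_const_mul _ (fun l : ℝ => l) L, cfc_id' ℝ L]
    rw [e1, e2]
    exact cfc_mono fun l hl => mul_le_mul_of_nonneg_right
      ((le_abs_self l).trans (spectrum.norm_le_norm_mul_of_mem hl))
      (spectrum_nonneg_of_nonneg hL hl)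
  have h1 := re_inner_le_of_le hop x
  rwa [re_inner_mul_self hsa, smul_apply, re_inner_real_smul] at h1

/-- The approximate kernel of `L` is invariant under `U*`, because `U L U* ≤ L`. -/
lemma tendsto_apply_star (hL : 0 ≤ L) (hUL : U * L * star U ≤ L) {x : ℕ → H} {C : ℝ}
    (hC : ∀ k, ‖x k‖ ≤ C) (hx : Tendsto (fun k => L (x k)) atTop (𝓝 0)) :
    Tendsto (fun k => L (star U (x k))) atTop (𝓝 0) := by
  obtain ⟨M, hM⟩ := norm_sq_apply_le_re_inner hL
  have h1 : Tendsto (fun k => |M| * (‖L (x k)‖ * C)) atTop (𝓝 0) := by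
    simpa using (hx.norm.mul_const C).const_mul |M|
  have h2 := squeeze_zero (fun k => sq_nonneg ‖L (star U (x k))‖) (fun k => ?_) h1
  · rw [tendsto_zero_iff_norm_tendsto_zero]
    simpa using h2.sqrt
  · have h3 := hM (star U (x k))
    have h4 := re_inner_star_apply_le hUL (x k)
    have h5 : (inner ℂ (L (x k)) (x k)).re ≤ ‖L (x k)‖ * C :=
      (re_inner_le_norm (𝕜 := ℂ) _ _).trans (mul_le_mul_of_nonneg_left (hC k) (norm_nonneg _))
    have h6 : 0 ≤ (inner ℂ (L (star U (x k))) (star U (x k))).re := by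
      simpa using re_inner_le_of_le hL (star U (x k))
    exact (h3.trans (mul_le_mul_of_nonneg_right (le_abs_self M) h6)).trans
      (mul_le_mul_of_nonneg_left (h4.trans h5) (abs_nonneg M))

lemma tendsto_apply_star_pow (hU : U ∈ unitary (H →L[ℂ] H)) (hL : 0 ≤ L)
    (hUL : U * L * star U ≤ L) {x : ℕ → H} {C : ℝ} (hC : ∀ k, ‖x k‖ ≤ C)
    (hx : Tendsto (fun k => L (x k)) atTop (𝓝 0)) (q : ℕ) :
    Tendsto (fun k => L ((star U ^ q) (x k))) atTop (𝓝 0) := by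
  induction q with
  | zero => simpa using hx
  | succ q ih =>
    have := tendsto_apply_star hL hUL (C := C) (fun k => by
      rw [norm_apply_of_mem_unitary (pow_mem (Unitary.star_mem hU) q)]
      exact hC k) ih
    simp only [pow_succ']
    exact this

/-- From an approximate kernel of `(B, L)` the isometry `V = U*` produces approximate eigenvectors.
Each step replaces `z` by the longer one of `(V ^ q ± b) z`, where `b ^ 2 = c`; the parallelogram law
gains a factor `√2`, while `(V ^ q ∓ b) (V ^ q ± b) z = (V ^ (2 q) - c) z` keeps its size. -/
lemma exists_long_approx_eigen (hU : U ∈ unitary (H →L[ℂ] H)) (hL : 0 ≤ L)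
    (hUL : U * L * star U ≤ L) {B : H →L[ℂ] H} (hBU : Commute B (star U)) {x : ℕ → H}
    (hx1 : ∀ k, ‖x k‖ = 1) (hxB : Tendsto (fun k => B (x k)) atTop (𝓝 0))
    (hxL : Tendsto (fun k => L (x k)) atTop (𝓝 0)) (p : ℕ) :
    ∀ q : ℕ, ∃ (c : ℕ → ℂ) (z : ℕ → H) (C : ℝ), (∀ k, ‖c k‖ = 1) ∧ (∀ k, ‖z k‖ ≤ C) ∧
      (∀ k, 2 ^ p ≤ ‖z k‖ ^ 2) ∧ (∀ k, ‖(star U ^ q) (z k) - c k • z k‖ ≤ 2) ∧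
      Tendsto (fun k => B (z k)) atTop (𝓝 0) ∧ Tendsto (fun k => L (z k)) atTop (𝓝 0) := by
  have hVn : ∀ q (y : H), ‖(star U ^ q) y‖ = ‖y‖ := fun q y =>
    norm_apply_of_mem_unitary (pow_mem (Unitary.star_mem hU) q) y
  induction p with
  | zero =>
    refine fun q => ⟨fun _ => 1, x, 1, by simp, fun k => (hx1 k).le, by simp [hx1], fun k => ?_,
      hxB, hxL⟩
    refine (norm_sub_le _ _).trans ?_
    rw [hVn, one_smul, hx1]
    norm_num
  | succ p ih =>
    intro q
    obtain ⟨c, z, C, hc, hzC, hzp, hz2, hzB, hzL⟩ := ih (2 * q)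
    set W := star U ^ q with hW
    have hstep : ∀ k, ∃ b : ℂ, ‖b‖ = 1 ∧ b ^ 2 = c k ∧ 2 ^ (p + 1) ≤ ‖W (z k) - b • z k‖ ^ 2 := by
      intro k
      obtain ⟨b, hb⟩ := IsAlgClosed.exists_pow_nat_eq (c k) (n := 2) (by norm_num)
      have hb1 : ‖b‖ = 1 := by
        have : ‖b‖ ^ 2 = 1 := by rw [← norm_pow, hb, hc]
        exact (pow_eq_one_iff_of_nonneg (norm_nonneg _) two_ne_zero).mp this
      have hpar := parallelogram_law_with_norm ℂ (W (z k)) (b • z k)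
      rw [hVn, norm_smul, hb1, one_mul] at hpar
      have := hzp k
      by_cases h : 2 ^ (p + 1) ≤ ‖W (z k) - b • z k‖ ^ 2
      · exact ⟨b, hb1, hb, h⟩
      · refine ⟨-b, by rwa [norm_neg], by rwa [neg_sq], ?_⟩
        rw [neg_smul, sub_neg_eq_add]
        rw [pow_succ] at h ⊢
        nlinarith
    choose b hb1 hb2 hbp using hstep
    have hcomb : ∀ {D : H →L[ℂ] H}, Tendsto (fun k => D (z k)) atTop (𝓝 0) →
        Tendsto (fun k => D (W (z k))) atTop (𝓝 0) →
        Tendsto (fun k => D (W (z k) - b k • z k)) atTop (𝓝 0) := fun {D} h1 h2 => by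
      have h3 : Tendsto (fun k => b k • D (z k)) atTop (𝓝 0) := by
        rw [tendsto_zero_iff_norm_tendsto_zero] at h1 ⊢
        simpa only [norm_smul, hb1, one_mul] using h1
      simpa using h2.sub h3
    have hBW : ∀ y, B (W y) = W (B y) := fun y =>
      congrArg (fun D : H →L[ℂ] H => D y) (hBU.pow_right q).eq
    refine ⟨fun k => -b k, fun k => W (z k) - b k • z k, C + C, fun k => by rw [norm_neg, hb1],
      fun k => ?_, hbp, fun k => ?_, hcomb hzB ?_,
      hcomb hzL (tendsto_apply_star_pow hU hL hUL hzC hzL q)⟩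
    · refine (norm_sub_le _ _).trans ?_
      rw [hVn, norm_smul, hb1, one_mul]
      exact add_le_add (hzC k) (hzC k)
    · refine le_trans (le_of_eq ?_) (hz2 k)
      congr 1
      have : (star U ^ (2 * q)) (z k) = W (W (z k)) := by rw [two_mul, pow_add]; rfl
      rw [this, map_sub, map_smul, ← hb2, pow_two, mul_smul, smul_sub, neg_smul, neg_smul]
      abel
    · simp only [hBW]
      have := (W.continuous.tendsto 0).comp hzB
      rwa [map_zero] at this

/-- If `(B, L)` has a joint approximate kernel, some point of the unit circle is a joint
approximate eigenvalue of `(U*, B, L)`. -/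
lemma exists_circle_approx_eigen (hU : U ∈ unitary (H →L[ℂ] H)) (hL : 0 ≤ L)
    (hUL : U * L * star U ≤ L) {B : H →L[ℂ] H} (hBU : Commute B (star U))
    (h : JointApproxKernel ![B, L]) :
    ∃ (u : ℂ) (x : ℕ → H), ‖u‖ = 1 ∧ (∀ k, ‖x k‖ = 1) ∧
      Tendsto (fun k => B (x k)) atTop (𝓝 0) ∧ Tendsto (fun k => L (x k)) atTop (𝓝 0) ∧
      Tendsto (fun k => star U (x k) - star u • x k) atTop (𝓝 0) := by
  obtain ⟨x, hx1, hxB, hxL⟩ := jointApproxKernel_pair_iff.mp h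
  have key : ∀ m : ℕ, ∃ (c : ℂ) (w : H), ‖c‖ = 1 ∧ ‖w‖ = 1 ∧ ‖B w‖ ≤ 1 / ((m : ℝ) + 1) ∧
      ‖L w‖ ≤ 1 / ((m : ℝ) + 1) ∧ ‖star U w - c • w‖ ≤ 1 / ((m : ℝ) + 1) := by
    intro m
    have hm : (0 : ℝ) < 1 / ((m : ℝ) + 1) := by positivity
    -- with `‖z k‖ ≥ 2 (m + 1)` the error `2` becomes at most `1 / (m + 1)` after normalisation
    obtain ⟨p, hp⟩ := pow_unbounded_of_one_lt ((2 * ((m : ℝ) + 1)) ^ 2) (one_lt_two)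
    obtain ⟨c, z, C, hc, -, hzp, hz2, hzB, hzL⟩ :=
      exists_long_approx_eigen hU hL hUL hBU hx1 hxB hxL p 1
    have e1 := (tendsto_zero_iff_norm_tendsto_zero.mp hzB).eventually_le_const hm
    have e2 := (tendsto_zero_iff_norm_tendsto_zero.mp hzL).eventually_le_const hm
    obtain ⟨k, hk1, hk2⟩ := (e1.and e2).exists
    have hz : 2 * ((m : ℝ) + 1) ≤ ‖z k‖ :=
      le_of_sq_le_sq (hp.le.trans (hzp k)) (norm_nonneg _)
    have hz0 : 0 < ‖z k‖ := lt_of_lt_of_le (by positivity) hz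
    have hz1 : ‖z k‖⁻¹ ≤ 1 := inv_le_one_of_one_le₀ (by linarith [(m.cast_nonneg : (0 : ℝ) ≤ m)])
    have hsc : ∀ y : H, ‖((‖z k‖⁻¹ : ℝ) : ℂ) • y‖ = ‖z k‖⁻¹ * ‖y‖ := fun y => by
      rw [norm_smul, Complex.norm_real, norm_inv, norm_norm]
    refine ⟨c k, ((‖z k‖⁻¹ : ℝ) : ℂ) • z k, hc k, ?_, ?_, ?_, ?_⟩
    · rw [hsc, inv_mul_cancel₀ hz0.ne']
    · rw [map_smul, hsc]
      exact (mul_le_of_le_one_left (norm_nonneg _) hz1).trans hk1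
    · rw [map_smul, hsc]
      exact (mul_le_of_le_one_left (norm_nonneg _) hz1).trans hk2
    · rw [map_smul, smul_comm, ← smul_sub, hsc, inv_mul_le_iff₀ hz0, mul_one_div,
        le_div_iff₀ (by positivity)]
      have h2 := hz2 k
      rw [pow_one] at h2
      nlinarith [(m.cast_nonneg : (0 : ℝ) ≤ m)]
  choose c w hc hw hwB hwL hwU using key
  obtain ⟨c₀, hc₀, φ, hφ, hlim⟩ := (isCompact_sphere (0 : ℂ) 1).tendsto_subseq (x := c)
    (fun m => by simpa using hc m)
  have hsmall {y : ℕ → H} (hy : ∀ m, ‖y m‖ ≤ 1 / ((m : ℝ) + 1)) : Tendsto y atTop (𝓝 0) :=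
    squeeze_zero_norm hy tendsto_one_div_add_atTop_nhds_zero_nat
  refine ⟨star c₀, w ∘ φ, by simpa using hc₀, fun k => hw _,
    (hsmall hwB).comp hφ.tendsto_atTop, (hsmall hwL).comp hφ.tendsto_atTop, ?_⟩
  have h1 := (hsmall hwU).comp hφ.tendsto_atTop
  have h2 : Tendsto (fun k => (c (φ k) - c₀) • w (φ k)) atTop (𝓝 0) := by
    have := (tendsto_sub_nhds_zero_iff.mpr hlim).norm
    rw [norm_zero] at this
    rw [tendsto_zero_iff_norm_tendsto_zero]
    simpa only [norm_smul, hw, mul_one, Function.comp_apply] using this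
  have h3 := h1.add h2
  rw [add_zero] at h3
  refine h3.congr fun k => ?_
  simp only [Function.comp_apply, star_star, sub_smul]
  abel

lemma cfc_sub_zero (hL : 0 ≤ L) : cfc (fun l : ℝ => l - 0) L = L := by
  have hsa : IsSelfAdjoint L := .of_nonneg hL
  simp only [sub_zero]
  exact cfc_id' ℝ L

lemma exists_unit_mul {w : ℂ} (hw : w ≠ 0) : ∃ u : ℂ, ‖u‖ = 1 ∧ w = (‖w‖ : ℂ) * u := by
  have h : (‖w‖ : ℂ) ≠ 0 := by simpa using hw
  exact ⟨w / ‖w‖, by simp [hw], by field_simp⟩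

lemma mul_cfc_linExp_zero_sub (hL : 0 ≤ L) (a : ℝ) (u : ℂ) :
    U * cfc (linExp 0) L - ((linExp 0 a : ℂ) * u) • (1 : H →L[ℂ] H) =
      U * L - ((a : ℂ) * u) • (1 : H →L[ℂ] H) := by
  have hsa : IsSelfAdjoint L := .of_nonneg hL
  rw [linExp_zero, cfc_id ℝ L, id]

lemma tendsto_apply_of_mul (hU : U ∈ unitary (H →L[ℂ] H)) {A : H →L[ℂ] H} {x : ℕ → H}
    (hx : Tendsto (fun k => (U * A) (x k)) atTop (𝓝 0)) :
    Tendsto (fun k => A (x k)) atTop (𝓝 0) := by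
  rw [tendsto_zero_iff_norm_tendsto_zero] at hx ⊢
  exact hx.congr fun k => norm_apply_of_mem_unitary hU _

lemma star_mul_self_adjoint_apply {A : H →L[ℂ] H} (hA : IsSelfAdjoint A) (x : H) :
    star (U * A) x = A (star U x) := by
  rw [star_mul, hA.star_eq]
  rfl

lemma norm_le_norm_exp_apply (hL : 0 ≤ L) (x : H) : ‖x‖ ≤ ‖cfc Real.exp L x‖ := by
  have hsa : IsSelfAdjoint L := .of_nonneg hL
  have h := norm_cfc_apply_le (L := L) (f := fun _ => 1) (g := Real.exp) (by fun_prop)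
    (by fun_prop) zero_le_one (fun l hl => by
      rw [one_mul, abs_one, Real.abs_exp]
      exact Real.one_le_exp (spectrum_nonneg_of_nonneg hL hl)) x
  rwa [cfc_const_one ℝ L, one_mul] at h

lemma norm_sq_add_norm_sq_le (hL : 0 ≤ L) (x : H) :
    ‖L x‖ ^ 2 + ‖x‖ ^ 2 ≤ ‖cfc Real.exp L x‖ ^ 2 := by
  have hsa : IsSelfAdjoint L := .of_nonneg hL
  have hop : L * L + 1 ≤ cfc Real.exp L * cfc Real.exp L := by
    have e1 : L * L + 1 = cfc (fun l : ℝ => l * l + 1) L := by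
      rw [cfc_add (a := L) (fun l : ℝ => l * l) (fun _ => 1), cfc_mul (fun l : ℝ => l) (fun l : ℝ => l) L,
        cfc_id' ℝ L, cfc_const_one ℝ L]
    rw [e1, ← cfc_mul Real.exp Real.exp L]
    refine cfc_mono fun l hl => ?_
    have h0 := spectrum_nonneg_of_nonneg hL hl
    have h1 := Real.add_one_le_exp l
    nlinarith
  have h := re_inner_le_of_le hop x
  have h2 : (inner ℂ x x).re = ‖x‖ ^ 2 := inner_self_eq_norm_sq (𝕜 := ℂ) x
  rw [re_inner_mul_self (cfc_isSelfAdjoint _ _), add_apply, inner_add_left, Complex.add_re,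
    re_inner_mul_self hsa] at h
  exact h2 ▸ h

/-- Approximate eigenvectors of `U L` are normal: they are approximate eigenvectors of the adjoint. -/
lemma tendsto_star_mul_of_tendsto (hU : U ∈ unitary (H →L[ℂ] H)) (hL : 0 ≤ L)
    (hUL : U * L * star U ≤ L) (w : ℂ) {x : ℕ → H} (hx1 : ∀ k, ‖x k‖ = 1)
    (hx : Tendsto (fun k => (U * L - w • (1 : H →L[ℂ] H)) (x k)) atTop (𝓝 0)) :
    Tendsto (fun k => star (U * L - w • (1 : H →L[ℂ] H)) (x k)) atTop (𝓝 0) := by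
  have ht : (0 : ℝ) ∈ Set.Icc (0 : ℝ) 1 := ⟨le_rfl, zero_le_one⟩
  rcases eq_or_ne w 0 with rfl | hw
  · rw [zero_smul, sub_zero] at hx ⊢
    simp only [star_mul_self_adjoint_apply (IsSelfAdjoint.of_nonneg hL)]
    exact tendsto_apply_star hL hUL (fun k => (hx1 k).le) (tendsto_apply_of_mul hU hx)
  · obtain ⟨u, hu, hwu⟩ := exists_unit_mul hw
    rw [hwu, ← mul_cfc_linExp_zero_sub hL] at hx ⊢
    have hr : 0 < linExp 0 ‖w‖ := by simpa [linExp_zero] using hw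
    obtain ⟨h1, h2⟩ := tendsto_of_approx_eigen hU hL hUL ht (norm_nonneg w) hr hu hx1 hx
    exact tendsto_star_sub_of_tendsto hL ht h1 h2

/-- Approximate eigenvectors of `U exp(L)` are approximate eigenvectors of the adjoint. -/
lemma tendsto_star_mul_exp_of_tendsto (hU : U ∈ unitary (H →L[ℂ] H)) (hL : 0 ≤ L)
    (hUL : U * L * star U ≤ L) (z : ℂ) {x : ℕ → H} (hx1 : ∀ k, ‖x k‖ = 1)
    (hx : Tendsto (fun k => (U * cfc Real.exp L - z • (1 : H →L[ℂ] H)) (x k)) atTop (𝓝 0)) :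
    Tendsto (fun k => star (U * cfc Real.exp L - z • (1 : H →L[ℂ] H)) (x k)) atTop (𝓝 0) := by
  have ht : (1 : ℝ) ∈ Set.Icc (0 : ℝ) 1 := ⟨zero_le_one, le_rfl⟩
  -- `U exp(L)` expands, so there is no approximate eigenvalue inside the unit disc
  have hz : 1 ≤ ‖z‖ := by
    have hlim : Tendsto (fun k => ‖(U * cfc Real.exp L - z • (1 : H →L[ℂ] H)) (x k)‖ + ‖z‖) atTop
        (𝓝 ‖z‖) := by simpa using hx.norm.add_const ‖z‖
    refine ge_of_tendsto' hlim fun k => ?_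
    have h1 := norm_le_norm_exp_apply hL (x k)
    rw [hx1, ← norm_apply_of_mem_unitary hU] at h1
    have h2 : ‖(z • (1 : H →L[ℂ] H)) (x k)‖ = ‖z‖ := by
      rw [smul_apply, norm_smul]
      change ‖z‖ * ‖x k‖ = _
      rw [hx1, mul_one]
    have h3 := norm_le_norm_sub_add ((U * cfc Real.exp L) (x k)) ((z • (1 : H →L[ℂ] H)) (x k))
    rw [h2] at h3
    exact h1.trans h3
  have hz0 : 0 < ‖z‖ := by linarith
  obtain ⟨u, hu, hzu⟩ := exists_unit_mul (norm_pos_iff.mp hz0)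
  obtain ⟨a, ha, haz⟩ : ∃ a : ℝ, 0 ≤ a ∧ linExp 1 a = ‖z‖ :=
    ⟨Real.log ‖z‖, Real.log_nonneg hz, by rw [linExp_one, Real.exp_log hz0]⟩
  have hza : z = (linExp 1 a : ℂ) * u := by rwa [haz]
  rw [hza, ← linExp_one] at hx ⊢
  obtain ⟨h1, h2⟩ := tendsto_of_approx_eigen hU hL hUL ht ha (haz ▸ hz0) hu hx1 hx
  exact tendsto_star_sub_of_tendsto hL ht h1 h2

/-- From `U L` to `U exp(L)`, one variable, relative to a commuting self-adjoint `B`. -/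
lemma exists_jointApproxKernel_star_exp (hU : U ∈ unitary (H →L[ℂ] H)) (hL : 0 ≤ L)
    (hUL : U * L * star U ≤ L) {B : H →L[ℂ] H} (hB : IsSelfAdjoint B) (hBU : Commute B U)
    (hBL : Commute B L) {w : ℂ}
    (h : JointApproxKernel ![B, star (U * L - w • (1 : H →L[ℂ] H))]) :
    ∃ (a : ℝ) (u : ℂ), ‖u‖ = 1 ∧ w = a * u ∧ JointApproxKernel ![B, star (U * cfc Real.exp L -
        ((Real.exp a : ℂ) * u) • (1 : H →L[ℂ] H))] := by
  rcases eq_or_ne w 0 with rfl | hw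
  · obtain ⟨x, hx1, hxB, hxL⟩ := jointApproxKernel_pair_iff.mp h
    have hBU' : Commute B (star U) := by simpa [hB.star_eq] using hBU.star_star
    have hker : JointApproxKernel ![B, L] := by
      refine jointApproxKernel_pair_iff.mpr ⟨fun k => star U (x k), fun k => by
        rw [norm_apply_of_mem_unitary (Unitary.star_mem hU), hx1], ?_, ?_⟩
      · have h1 := ((star U).continuous.tendsto 0).comp hxB
        rw [map_zero] at h1
        exact h1.congr fun k => (congrArg (fun D : H →L[ℂ] H => D (x k)) hBU'.eq).symm
      · refine hxL.congr fun k => ?_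
        rw [zero_smul, sub_zero, star_mul_self_adjoint_apply (.of_nonneg hL)]
    obtain ⟨u, y, hu, hy1, hyB, hyL, hyU⟩ := exists_circle_approx_eigen hU hL hUL hBU' hker
    refine ⟨0, u, hu, by simp, jointApproxKernel_pair_iff.mpr ⟨y, hy1, hyB, ?_⟩⟩
    have := tendsto_star_sub_of_tendsto hL (t := 1) (a := 0) ⟨zero_le_one, le_rfl⟩
      (by rwa [cfc_sub_zero hL]) hyU
    simpa only [linExp_one] using this
  · obtain ⟨u, hu, hwu⟩ := exists_unit_mul hw
    refine ⟨‖w‖, u, hu, hwu, ?_⟩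
    rw [hwu] at h
    exact (jointApproxKernel_star_iff_of_pos hU hL hUL hB hBU hBL (norm_pos_iff.mpr hw) hu).mp h

/-- From `U exp(L)` to `U L`, one variable, relative to a commuting self-adjoint `B`. -/
lemma jointApproxKernel_star_of_exp (hU : U ∈ unitary (H →L[ℂ] H)) (hL : 0 ≤ L)
    (hUL : U * L * star U ≤ L) {B : H →L[ℂ] H} (hB : IsSelfAdjoint B) (hBU : Commute B U)
    (hBL : Commute B L) {a : ℝ} {u : ℂ} (hu : ‖u‖ = 1)
    (h : JointApproxKernel ![B, star (U * cfc Real.exp L -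
      ((Real.exp a : ℂ) * u) • (1 : H →L[ℂ] H))]) :
    JointApproxKernel ![B, star (U * L - ((a : ℂ) * u) • (1 : H →L[ℂ] H))] := by
  rcases lt_or_ge 0 a with ha | ha
  · exact (jointApproxKernel_star_iff_of_pos hU hL hUL hB hBU hBL ha hu).mpr h
  obtain ⟨x, hx1, hxB, hxE⟩ := jointApproxKernel_pair_iff.mp h
  set δ : ℕ → ℝ := fun k =>
    ‖star (U * cfc Real.exp L - ((Real.exp a : ℂ) * u) • (1 : H →L[ℂ] H)) (x k)‖
  have hδ : Tendsto δ atTop (𝓝 0) := tendsto_zero_iff_norm_tendsto_zero.mp hxE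
  have hE : ∀ k, ‖cfc Real.exp L (star U (x k))‖ ≤ Real.exp a + δ k := fun k => by
    have h1 : star (U * cfc Real.exp L - ((Real.exp a : ℂ) * u) • (1 : H →L[ℂ] H)) (x k) =
        cfc Real.exp L (star U (x k)) - star ((Real.exp a : ℂ) * u) • x k := by
      rw [star_sub, sub_apply, star_mul_self_adjoint_apply (cfc_isSelfAdjoint _ _), star_smul,
        star_one, smul_apply, one_apply_eq_self]
    have h2 : ‖star ((Real.exp a : ℂ) * u) • x k‖ = Real.exp a := by
      rw [norm_smul, norm_star, norm_mul, hu, hx1, Complex.norm_real, Real.norm_of_nonneg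
        (Real.exp_pos a).le, mul_one, mul_one]
    have h3 := norm_le_norm_add_norm_sub' (cfc Real.exp L (star U (x k)))
      (star ((Real.exp a : ℂ) * u) • x k)
    rwa [h2, ← h1] at h3
  have hy1 : ∀ k, ‖star U (x k)‖ = 1 := fun k => by
    rw [norm_apply_of_mem_unitary (Unitary.star_mem hU), hx1]
  -- `exp(L) ≥ 1` rules out `a < 0`
  have ha0 : a = 0 := by
    have hlim : Tendsto (fun k => Real.exp a + δ k) atTop (𝓝 (Real.exp a)) := by
      simpa using hδ.const_add (Real.exp a)
    have h1 : 1 ≤ Real.exp a := ge_of_tendsto' hlim fun k =>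
      (hy1 k).symm.le.trans ((norm_le_norm_exp_apply hL _).trans (hE k))
    exact le_antisymm ha (Real.one_le_exp_iff.mp h1)
  subst ha0
  refine jointApproxKernel_pair_iff.mpr ⟨x, hx1, hxB, ?_⟩
  simp only [Complex.ofReal_zero, zero_mul, zero_smul,
    sub_zero, star_mul_self_adjoint_apply (IsSelfAdjoint.of_nonneg hL)]
  have hlim : Tendsto (fun k => (1 + δ k) ^ 2 - 1) atTop (𝓝 0) := by
    simpa using ((hδ.const_add 1).pow 2).sub_const 1
  have hsq := squeeze_zero (fun k => sq_nonneg ‖L (star U (x k))‖) (fun k => ?_) hlim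
  · rw [tendsto_zero_iff_norm_tendsto_zero]
    simpa using hsq.sqrt
  · have h1 := norm_sq_add_norm_sq_le hL (star U (x k))
    have h2 := hE k
    rw [Real.exp_zero] at h2
    rw [hy1] at h1
    nlinarith [norm_nonneg (cfc Real.exp L (star U (x k)))]

end PolarPath

/-! ### Taylor spectra of doubly commuting tuples -/

section Tuples

variable {H : Type*} [NormedAddCommGroup H] [InnerProductSpace ℂ H] [CompleteSpace H]

lemma DoublyCommuting.sub_smul_one {n : ℕ} {A : Fin n → H →L[ℂ] H} (hA : DoublyCommuting A)
    (z : Fin n → ℂ) : DoublyCommuting fun j => A j - z j • (1 : H →L[ℂ] H) := by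
  have h1 : ∀ (c : ℂ) (X : H →L[ℂ] H), Commute X (c • (1 : H →L[ℂ] H)) := fun c X =>
    (Commute.one_right X).smul_right c
  refine ⟨fun i j => ?_, fun i j hij => ?_⟩
  · exact ((hA.1 i j).sub_right (h1 _ _)).sub_left ((h1 _ _).symm)
  · rw [star_sub, star_smul, star_one]
    exact ((hA.2 i j hij).sub_right (h1 _ _)).sub_left ((h1 _ _).symm)

/-- If approximate eigenvectors of each `A j` are approximate eigenvectors of `(A j)*`, the Taylor
spectrum of a doubly commuting tuple is its right joint approximate spectrum: whichever diagonal
entry of the Koszul Laplacian fails to be invertible, the vectors that witness it also witness the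
failure of `∑ⱼ (Aⱼ - zⱼ) (Aⱼ - zⱼ)*`. -/
lemma mem_taylorSpectrum_iff {n : ℕ} {A : Fin n → H →L[ℂ] H} (hA : DoublyCommuting A)
    {z : Fin n → ℂ}
    (hstar : ∀ j, ∀ x : ℕ → H, (∀ k, ‖x k‖ = 1) →
      Tendsto (fun k => (A j - z j • (1 : H →L[ℂ] H)) (x k)) atTop (𝓝 0) →
      Tendsto (fun k => star (A j - z j • (1 : H →L[ℂ] H)) (x k)) atTop (𝓝 0)) :
    z ∈ taylorSpectrum A ↔ JointApproxKernel fun j => star (A j - z j • (1 : H →L[ℂ] H)) := by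
  refine ⟨fun hz => ?_, not_koszulExact_of_jointApproxKernel⟩
  obtain ⟨t, ht⟩ := not_forall.mp (mt (koszulExact_of_isUnit (hA.sub_smul_one z)) hz)
  obtain ⟨x, hx1, hx⟩ := jointApproxKernel_of_not_isUnit
    (C := fun j => if j ∈ t then A j - z j • (1 : H →L[ℂ] H)
      else star (A j - z j • (1 : H →L[ℂ] H))) (by
    convert ht using 3 with j
    split_ifs <;> simp)
  refine ⟨x, hx1, fun j => ?_⟩
  have hj := hx j
  by_cases h : j ∈ t
  · simp only [h, if_true] at hj
    exact hstar j x hx1 hj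
  · simpa only [h, if_false] using hj

/-- Replacing the members of a family one at a time: `R j` is the set of admissible replacements
of `C j`, and the `j`-th replacement is possible relative to any self-adjoint operator that commutes
with `G j`. -/
lemma exists_jointApproxKernel_replace {ι : Type*} [Fintype ι] [DecidableEq ι]
    {C : ι → H →L[ℂ] H} {R : ι → Set (H →L[ℂ] H)} {G : ι → Set (H →L[ℂ] H)}
    (hstep : ∀ j B, IsSelfAdjoint B → (∀ D ∈ G j, Commute B D) → JointApproxKernel ![B, C j] →
      ∃ D ∈ R j, JointApproxKernel ![B, D])
    (hG : ∀ j, ∀ D ∈ G j, star D ∈ G j)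
    (hC : ∀ i j, i ≠ j → ∀ D ∈ G j, Commute (C i) D)
    (hR : ∀ i j, i ≠ j → ∀ E ∈ R i, ∀ D ∈ G j, Commute E D) (h : JointApproxKernel C) :
    ∃ D : ι → H →L[ℂ] H, (∀ i, D i ∈ R i) ∧ JointApproxKernel D := by
  suffices hs : ∀ s : Finset ι, ∃ D : ι → H →L[ℂ] H, (∀ i ∈ s, D i ∈ R i) ∧
      (∀ i, i ∉ s → D i = C i) ∧ JointApproxKernel D by
    obtain ⟨D, hD, -, hDk⟩ := hs Finset.univ
    exact ⟨D, fun i => hD i (Finset.mem_univ i), hDk⟩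
  intro s
  induction s using Finset.induction_on with
  | empty => exact ⟨C, by simp, by simp, h⟩
  | insert j s hj ih =>
    obtain ⟨D, hDR, hDC, hDk⟩ := ih
    rw [jointApproxKernel_iff_pair D j, hDC j hj] at hDk
    have hcomm : ∀ i, i ≠ j → ∀ X ∈ G j, Commute (D i) X := fun i hij X hX => by
      by_cases hi : i ∈ s
      · exact hR i j hij _ (hDR i hi) X hX
      · rw [hDC i hi]
        exact hC i j hij X hX
    obtain ⟨E, hE, hEk⟩ := hstep j (∑ i ∈ Finset.univ.erase j, star (D i) * D i) (by
      rw [isSelfAdjoint_iff, star_sum]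
      simp) (fun X hX => Commute.sum_left _ _ _ fun i hi => by
        have hij := Finset.ne_of_mem_erase hi
        refine Commute.mul_left ?_ (hcomm i hij X hX)
        simpa using (hcomm i hij _ (hG j X hX)).star_star) hDk
    refine ⟨Function.update D j E, fun i hi => ?_, fun i hi => ?_, ?_⟩
    · rcases eq_or_ne i j with rfl | hij
      · simpa using hE
      · rw [Function.update_of_ne hij]
        exact hDR i ((Finset.mem_insert.mp hi).resolve_left hij)
    · rw [Finset.mem_insert, not_or] at hi
      rw [Function.update_of_ne hi.1, hDC i hi.2]
    · rw [jointApproxKernel_iff_pair _ j, Function.update_self]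
      have hsum : ∑ i ∈ Finset.univ.erase j,
          star (Function.update D j E i) * Function.update D j E i =
          ∑ i ∈ Finset.univ.erase j, star (D i) * D i := by
        refine Finset.sum_congr rfl fun i hi => ?_
        rw [Function.update_of_ne (Finset.ne_of_mem_erase hi)]
      rwa [hsum]

end Tuples

/-! ### Polar decompositions of log-hyponormal operators -/

section LogHyponormal

variable {H : Type*} [NormedAddCommGroup H] [InnerProductSpace ℂ H] [CompleteSpace H]
variable {T U : H →L[ℂ] H}

lemma isStrictlyPositive_abs (hT : IsUnit T) : IsStrictlyPositive (CFC.abs T) := by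
  refine IsUnit.isStrictlyPositive ?_ (CFC.abs_nonneg T)
  have h : IsUnit (CFC.abs T * CFC.abs T) := by
    rw [CFC.abs_mul_abs]
    exact hT.star.mul hT
  exact ((Commute.refl (CFC.abs T)).isUnit_mul_iff.mp h).1

lemma cfc_exp_log_abs (hT : IsUnit T) : cfc Real.exp (CFC.log (CFC.abs T)) = CFC.abs T := by
  rw [CFC.real_exp_eq_normedSpace_exp IsSelfAdjoint.log, CFC.exp_log _ (isStrictlyPositive_abs hT)]

lemma log_unitary_conj (hU : U ∈ unitary (H →L[ℂ] H)) {a : H →L[ℂ] H} (ha : IsStrictlyPositive a) :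
    U * CFC.log a * star U = CFC.log (U * a * star U) := by
  refine StarAlgHomClass.map_cfc (R := ℝ) (S := ℝ) (Unitary.conjStarAlgAut ℝ (H →L[ℂ] H) ⟨U, hU⟩)
    Real.log a (Real.continuousOn_log.mono fun x hx => ?_) ?_ ha.isSelfAdjoint
    (ha.isSelfAdjoint.map _)
  · rintro rfl
    exact spectrum.zero_notMem ℝ ha.isUnit hx
  · change Continuous fun x : (H →L[ℂ] H) => U * x * star U
    fun_prop

/-- In terms of the polar decomposition `T = U |T|`, log-hyponormality reads
`U log|T| U* ≤ log|T|`. -/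
lemma unitary_conj_log_le (hT : IsLogHyponormal T) (hU : U ∈ unitary (H →L[ℂ] H))
    (hpolar : T = U * CFC.abs T) :
    U * CFC.log (CFC.abs T) * star U ≤ CFC.log (CFC.abs T) := by
  rw [log_unitary_conj hU (isStrictlyPositive_abs hT.1)]
  have hsa : star (CFC.abs T) = CFC.abs T := (IsSelfAdjoint.of_nonneg (CFC.abs_nonneg T)).star_eq
  have habs : CFC.abs (star T) = U * CFC.abs T * star U := by
    refine CFC.sqrt_unique ?_ (star_right_conjugate_nonneg (CFC.abs_nonneg T) U)
    have hTT : star (star T) * star T = U * CFC.abs T * (CFC.abs T * star U) := by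
      conv_lhs => rw [star_star, hpolar, star_mul, hsa]
    rw [hTT, mul_assoc (U * CFC.abs T), ← mul_assoc (star U), ← mul_assoc (star U),
      Unitary.star_mul_self_of_mem hU, one_mul]
  rw [← habs]
  exact hT.2

lemma log_abs_nonneg (hpos : ∀ x : H, x ≠ 0 → 0 < (inner ℂ (CFC.log (CFC.abs T) x) x).re) :
    0 ≤ CFC.log (CFC.abs T) := by
  rw [ContinuousLinearMap.nonneg_iff_isPositive, ContinuousLinearMap.isPositive_def']
  refine ⟨IsSelfAdjoint.log, fun x => ?_⟩
  rcases eq_or_ne x 0 with rfl | hx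
  · simp [ContinuousLinearMap.reApplyInnerSelf]
  · exact (hpos x hx).le

lemma Commute.abs_right {X : H →L[ℂ] H} (h : Commute X T) (h' : Commute X (star T)) :
    Commute X (CFC.abs T) :=
  (h.symm.cfcAbs_left (by simpa using h'.star_star.symm)).symm

lemma Commute.log_abs_right {X : H →L[ℂ] H} (h : Commute X T) (h' : Commute X (star T)) :
    Commute X (CFC.log (CFC.abs T)) :=
  (IsSelfAdjoint.commute_cfc (.of_nonneg (CFC.abs_nonneg T)) (h.abs_right h').symm _).symm

lemma Commute.polar_right {X : H →L[ℂ] H} (hT : IsUnit T) (hpolar : T = U * CFC.abs T)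
    (h : Commute X T) (h' : Commute X (CFC.abs T)) : Commute X U := by
  refine (isStrictlyPositive_abs hT).isUnit.mul_right_cancel ?_
  rw [mul_assoc, ← hpolar, h.eq, mul_assoc, h'.eq, ← mul_assoc, ← hpolar]

/-- The polar factors of a doubly commuting tuple of invertible operators commute across indices. -/
lemma DoublyCommuting.commute_polar {n : ℕ} {T U : Fin n → H →L[ℂ] H} (hT : DoublyCommuting T)
    (hunit : ∀ j, IsUnit (T j)) (hpolar : ∀ j, T j = U j * CFC.abs (T j)) {i j : Fin n}
    (hij : i ≠ j) {X Y : H →L[ℂ] H}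
    (hX : X ∈ ({U i, star (U i), CFC.log (CFC.abs (T i))} : Set (H →L[ℂ] H)))
    (hY : Y ∈ ({U j, star (U j), CFC.log (CFC.abs (T j))} : Set (H →L[ℂ] H))) : Commute X Y := by
  have hsaL : ∀ k, star (CFC.log (CFC.abs (T k))) = CFC.log (CFC.abs (T k)) := fun k =>
    IsSelfAdjoint.log.star_eq
  -- the three factors of index `k` commute with whatever commutes with `T k` and `(T k)*`
  have key : ∀ k (Z : H →L[ℂ] H), Commute Z (T k) → Commute Z (star (T k)) →
      ∀ W ∈ ({U k, star (U k), CFC.log (CFC.abs (T k))} : Set (H →L[ℂ] H)), Commute Z W := by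
    intro k Z h1 h2 W hW
    have hU : ∀ Z : H →L[ℂ] H, Commute Z (T k) → Commute Z (star (T k)) → Commute Z (U k) :=
      fun Z h1 h2 => h1.polar_right (hunit k) (hpolar k) (h1.abs_right h2)
    rcases hW with rfl | rfl | rfl
    · exact hU Z h1 h2
    · simpa using (hU (star Z) (by simpa using h2.star_star) h1.star_star).star_star
    · exact h1.log_abs_right h2
  have hji : Commute (T j) (star (T i)) := hT.2 j i hij.symm
  have hX1 : Commute X (T j) := (key i (T j) (hT.1 j i) hji X hX).symm
  have hX2 : Commute X (star (T j)) :=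
    (key i (star (T j)) (hT.2 i j hij).symm (hT.1 j i).star_star X hX).symm
  exact key j X hX1 hX2 Y hY

end LogHyponormal

theorem corollary2p4 {H : Type*} [NormedAddCommGroup H] [InnerProductSpace ℂ H] [CompleteSpace H]
    {n : ℕ} (T U S : Fin n → H →L[ℂ] H)
    (hT : DoublyCommuting T)
    (hlog : ∀ j, IsLogHyponormal (T j))
    (hpos : ∀ j, ∀ x : H, x ≠ 0 → 0 < (inner ℂ (CFC.log (CFC.abs (T j)) x) x).re)
    (hU : ∀ j, U j ∈ unitary (H →L[ℂ] H))
    (hpolar : ∀ j, T j = U j * CFC.abs (T j))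
    (hS : ∀ j, S j = U j * CFC.log (CFC.abs (T j))) :
    (∀ i j, Commute (S i) (S j)) ∧
      taylorSpectrum S =
        {w : Fin n → ℂ | ∃ r θ : Fin n → ℝ, (∀ j, 0 < r j) ∧
          (fun j => (r j : ℂ) * Complex.exp (Complex.I * (θ j : ℂ))) ∈ taylorSpectrum T ∧
          w = fun j => Complex.exp (Complex.I * (θ j : ℂ)) * (Real.log (r j) : ℂ)} := by
  set L : Fin n → H →L[ℂ] H := fun j => CFC.log (CFC.abs (T j)) with hLdef
  have hL : ∀ j, 0 ≤ L j := fun j => log_abs_nonneg (hpos j)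
  have hLsa : ∀ j, IsSelfAdjoint (L j) := fun j => .of_nonneg (hL j)
  have hUL : ∀ j, U j * L j * star (U j) ≤ L j := fun j =>
    unitary_conj_log_le (hlog j) (hU j) (hpolar j)
  have hTE : ∀ j, T j = U j * cfc Real.exp (L j) := fun j => by
    rw [hLdef, cfc_exp_log_abs (hlog j).1, ← hpolar j]
  let G : Fin n → Set (H →L[ℂ] H) := fun j => {U j, star (U j), L j}
  have hGstar : ∀ j, ∀ D ∈ G j, star D ∈ G j := by
    rintro j D (rfl | rfl | rfl)
    · exact Or.inr (Or.inl rfl)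
    · exact Or.inl (star_star _)
    · exact Or.inr (Or.inr (hLsa j).star_eq)
  have hGG : ∀ i j, i ≠ j → ∀ X ∈ G i, ∀ Y ∈ G j, Commute X Y := fun i j hij X hX Y hY =>
    hT.commute_polar (fun k => (hlog k).1) hpolar hij hX hY
  have hUG : ∀ j, U j ∈ G j := fun j => Or.inl rfl
  have hLG : ∀ j, L j ∈ G j := fun j => Or.inr (Or.inr rfl)
  have hSG : ∀ i j, i ≠ j → ∀ Y ∈ G j, Commute (S i) Y := fun i j hij Y hY => by
    rw [hS]
    exact (hGG i j hij _ (hUG i) Y hY).mul_left (hGG i j hij _ (hLG i) Y hY)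
  have hEG : ∀ i j, i ≠ j → ∀ Y ∈ G j, Commute (U i * cfc Real.exp (L i)) Y :=
    fun i j hij Y hY => (hGG i j hij _ (hUG i) Y hY).mul_left
      ((hLsa i).commute_cfc (hGG i j hij _ (hLG i) Y hY) _)
  have hshift : ∀ (A : H →L[ℂ] H) (c : ℂ) j, (∀ Y ∈ G j, Commute A Y) →
      ∀ Y ∈ G j, Commute (star (A - c • (1 : H →L[ℂ] H))) Y := fun A c j hA Y hY => by
    have h1 := (hA _ (hGstar j Y hY)).sub_left ((Commute.one_left (star Y)).smul_left c)
    simpa using h1.star_star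
  have hSDC : DoublyCommuting S := by
    refine ⟨fun i j => ?_, fun i j hij => ?_⟩
    · rcases eq_or_ne i j with rfl | hij
      · exact Commute.refl _
      · rw [hS j]
        exact (hSG i j hij _ (hUG j)).mul_right (hSG i j hij _ (hLG j))
    · rw [hS j, star_mul]
      exact (hSG i j hij _ (hGstar j _ (hLG j))).mul_right (hSG i j hij _ (hGstar j _ (hUG j)))
  refine ⟨hSDC.1, Set.ext fun w => ?_⟩
  have hmemS : ∀ w : Fin n → ℂ, w ∈ taylorSpectrum S ↔
      JointApproxKernel fun j => star (U j * L j - w j • (1 : H →L[ℂ] H)) := fun w => by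
    rw [mem_taylorSpectrum_iff hSDC fun j x hx1 hx => by
      rw [hS j] at hx ⊢
      exact tendsto_star_mul_of_tendsto (hU j) (hL j) (hUL j) (w j) hx1 hx]
    simp only [hS, hLdef]
  have hmemT : ∀ z : Fin n → ℂ, z ∈ taylorSpectrum T ↔
      JointApproxKernel fun j => star (U j * cfc Real.exp (L j) - z j • (1 : H →L[ℂ] H)) :=
    fun z => by
    rw [mem_taylorSpectrum_iff hT fun j x hx1 hx => by
      rw [hTE j] at hx ⊢
      exact tendsto_star_mul_exp_of_tendsto (hU j) (hL j) (hUL j) (z j) hx1 hx]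
    simp only [← hTE]
  have hnorm : ∀ θ : ℝ, ‖Complex.exp (Complex.I * (θ : ℂ))‖ = 1 := fun θ => by
    rw [mul_comm, Complex.norm_exp_ofReal_mul_I]
  constructor
  · intro hw
    let R : Fin n → Set (H →L[ℂ] H) := fun j => {D | ∃ (a : ℝ) (u : ℂ), ‖u‖ = 1 ∧ w j = a * u ∧
      D = star (U j * cfc Real.exp (L j) - ((Real.exp a : ℂ) * u) • (1 : H →L[ℂ] H))}
    obtain ⟨D, hD, hDk⟩ := exists_jointApproxKernel_replace (R := R) (G := G)
      (fun j B hB hBG h => by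
        obtain ⟨a, u, hu, hwu, hk⟩ := exists_jointApproxKernel_star_exp (hU j) (hL j) (hUL j) hB
          (hBG _ (hUG j)) (hBG _ (hLG j)) h
        exact ⟨_, ⟨a, u, hu, hwu, rfl⟩, hk⟩) hGstar
      (fun i j hij => hshift _ _ j (by rw [← hS i]; exact hSG i j hij))
      (by
        rintro i j hij _ ⟨a, u, -, -, rfl⟩
        exact hshift _ _ j (hEG i j hij)) ((hmemS w).mp hw)
    choose a u hu hwu hDu using hD
    have hθ : ∀ j, Complex.exp (Complex.I * ((u j).arg : ℂ)) = u j := fun j => by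
      have := Complex.norm_mul_exp_arg_mul_I (u j)
      rwa [hu, Complex.ofReal_one, one_mul, mul_comm] at this
    refine ⟨fun j => Real.exp (a j), fun j => (u j).arg, fun j => Real.exp_pos _, ?_, ?_⟩
    · rw [hmemT]
      simp only [hθ, ← hDu]
      exact hDk
    · funext j
      simp only
      rw [hθ, Real.log_exp, hwu, mul_comm]
  · rintro ⟨r, θ, hr, hz, rfl⟩
    rw [hmemT] at hz
    rw [hmemS]
    let R : Fin n → Set (H →L[ℂ] H) := fun j => {star (U j * L j -
      (Complex.exp (Complex.I * (θ j : ℂ)) * (Real.log (r j) : ℂ)) • (1 : H →L[ℂ] H))}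
    obtain ⟨D, hD, hDk⟩ := exists_jointApproxKernel_replace (R := R) (G := G)
      (fun j B hB hBG h => by
        refine ⟨_, rfl, ?_⟩
        rw [mul_comm (Complex.exp _)]
        refine jointApproxKernel_star_of_exp (hU j) (hL j) (hUL j) hB
          (hBG _ (hUG j)) (hBG _ (hLG j)) (hnorm (θ j)) ?_
        rwa [Real.exp_log (hr j)]) hGstar
      (fun i j hij => hshift _ _ j (hEG i j hij))
      (by
        rintro i j hij _ rfl
        exact hshift _ _ j (by rw [← hS i]; exact hSG i j hij)) hz
    rwa [show D = _ from funext hD] at hDk
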